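/- Let $n\ge 1$, let $\mathbb{B}_n$ and $\mathbb{S}_n=\partial\mathbb{B}_n$ be the open unit ball and the unit sphere of $\mathbb{C}^n$, let $\langle z,w\rangle=\sum_i z_i\overline{w_i}$, and let $\sigma$ be the Lebesgue (surface) measure on $\mathbb{S}_n$ normalized by $\sigma(\mathbb{S}_n)=1$. Put $$\widetilde\Delta:=4\sum_{i,j}\frac{1-|z|^2}{n+1}\,(\delta_{ij}-\overline{z}_i z_j)\,\bar\partial_i\partial_j,\qquad G(z):=\frac{n+1}{2n}\int_{|z|}^1(1-t^2)^{n-1}t^{-2n+1}\,dt,\qquad dg(z):=\frac{dV(z)}{(1-|z|^2)^{n+1}},$$ where $\partial_j=\frac12(\partial_{x_j}-i\partial_{y_j})$, $\bar\partial_j=\frac12(\partial_{x_j}+i\partial_{y_j})$ and $dV$ is Lebesgue measure. Let $H^2(\mathbb{B}_n)$ be the closure of the analytic polynomials in $L^2(\mathbb{S}_n,\sigma)$, with the norm of $L^2(\mathbb{S}_n,\sigma)$; its elements are continued analytically into the ball by $f(z)=\int_{\mathbb{S}_n} f(\xi)(1-\langle z,\xi\rangle)^{-n}\,d\sigma(\xi)$.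 Let $\varphi\le 0$ be a bounded invariant-subharmonic function on $\mathbb{B}_n$, that is, a bounded real-valued function of class $C^2$ on $\mathbb{B}_n$ with $\widetilde\Delta\varphi\ge 0$ there, and let $\|\varphi\|_\infty=\sup_{\mathbb{B}_n}|\varphi|$. Then $d\nu:=\frac{n!}{\pi^n}\,\widetilde\Delta\varphi\; G\,dg$ is a Carleson measure on $\mathbb{B}_n$, i.e. there is a constant $C<\infty$ with $\nu(\{z\in\mathbb{B}_n:|1-\langle z,\xi\rangle|<r\})\le C r^n$ for all $\xi\in\mathbb{S}_n$ and $r>0$; and for every $f\in H^2(\mathbb{B}_n)$ the integral below converges and $$\frac{n!}{\pi^n}\int_{\mathbb{B}_n}|f(z)|^2\,\widetilde\Delta\varphi(z)\,G(z)\,dg(z)\le e\,\|\varphi\|_\infty\,\|f\|_{H^2(\mathbb{B}_n)}^2 .$$ -/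

import Mathlib

open MeasureTheory Metric
open scoped NNReal ENNReal

namespace CarlesonBall

noncomputable section

/-- Complex Euclidean space `ℂⁿ`. -/
abbrev Cn (n : ℕ) : Type := EuclideanSpace ℂ (Fin n)

/-- The open unit ball `𝔹_n` of `ℂⁿ`. -/
abbrev unitBall (n : ℕ) : Set (Cn n) := ball (0 : Cn n) 1

/-- The unit sphere `𝕊_n = ∂𝔹_n` of `ℂⁿ`. -/
abbrev unitSphere (n : ℕ) : Set (Cn n) := sphere (0 : Cn n) 1

/-- The standard Hermitian inner product `⟨z, w⟩ = ∑ i, z i * conj (w i)`, linear in the first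
variable (Mathlib's `inner ℂ` is linear in the second one). -/
def herm {n : ℕ} (z w : Cn n) : ℂ := inner ℂ w z

/-! ### The Hardy space -/

/-- The surface (Lebesgue) measure on the sphere, normalized so that the sphere has measure `1`. -/
def sphereMeasure (n : ℕ) : Measure (unitSphere n) :=
  ((volume : Measure (Cn n)).toSphere Set.univ)⁻¹ • (volume : Measure (Cn n)).toSphere

/-- `L²(𝕊_n, σ)`. -/
abbrev SphereL2 (n : ℕ) : Type := Lp ℂ 2 (sphereMeasure n)

/-- The Hardy space `H²(𝔹_n)`: the closure of the analytic polynomials in `L²(𝕊_n, σ)`, with the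
norm inherited from `L²(𝕊_n, σ)`. -/
def hardySpace (n : ℕ) : Set (SphereL2 n) :=
  closure {g : SphereL2 n | ∃ p : MvPolynomial (Fin n) ℂ,
    ∀ᵐ ξ ∂(sphereMeasure n), g ξ = MvPolynomial.eval (fun i => (ξ : Cn n) i) p}

/-- The analytic continuation into the ball of an element `f` of the Hardy space, given by the
Cauchy-Szegő integral `f(z) = ∫ f(ξ) (1 - ⟨z, ξ⟩)⁻ⁿ dσ(ξ)`. -/
def hardyExt {n : ℕ} (f : SphereL2 n) (z : Cn n) : ℂ :=
  ∫ ξ, f ξ / (1 - herm z (ξ : Cn n)) ^ n ∂(sphereMeasure n)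

/-! ### The invariant Laplacian -/

/-- `∂_j u = (∂u/∂x_j - i ∂u/∂y_j) / 2`. -/
def dz {n : ℕ} (j : Fin n) (u : Cn n → ℂ) (z : Cn n) : ℂ :=
  (fderiv ℝ u z (EuclideanSpace.single j 1)
    - Complex.I * fderiv ℝ u z (EuclideanSpace.single j Complex.I)) / 2

/-- `∂̄_j u = (∂u/∂x_j + i ∂u/∂y_j) / 2`. -/
def dzbar {n : ℕ} (j : Fin n) (u : Cn n → ℂ) (z : Cn n) : ℂ :=
  (fderiv ℝ u z (EuclideanSpace.single j 1)
    + Complex.I * fderiv ℝ u z (EuclideanSpace.single j Complex.I)) / 2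

/-- The components `g^{ij} = (1 - |z|²) / (n + 1) * (δ_{ij} - conj (z_i) z_j)` of the inverse of
the Bergman metric. -/
def bergmanInv {n : ℕ} (i j : Fin n) (z : Cn n) : ℂ :=
  ((1 - ‖z‖ ^ 2 : ℝ) : ℂ) / (n + 1) * ((if i = j then 1 else 0) - starRingEnd ℂ (z i) * z j)

/-- The invariant Laplacian `4 ∑_{i,j} g^{ij} ∂̄_i ∂_j` on complex-valued functions. -/
def invLaplacianC {n : ℕ} (u : Cn n → ℂ) (z : Cn n) : ℂ :=
  4 * ∑ i, ∑ j, bergmanInv i j z * dzbar i (dz j u) z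

/-- The invariant Laplacian of a real-valued function `φ`; for `φ` of class `C²` the complex
number `invLaplacianC φ z` is real. -/
def invLaplacian {n : ℕ} (φ : Cn n → ℝ) (z : Cn n) : ℝ :=
  (invLaplacianC (fun w => (φ w : ℂ)) z).re

/-- `φ` is an invariant subharmonic function on the ball: it is of class `C²` there and its
invariant Laplacian is nonnegative. -/
structure IsInvSubharmonic {n : ℕ} (φ : Cn n → ℝ) : Prop where
  contDiffOn : ContDiffOn ℝ 2 φ (unitBall n)
  nonneg : ∀ z ∈ unitBall n, 0 ≤ invLaplacian φ z

/-! ### Green's function, the invariant measure, Carleson measures -/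

/-- Green's function with pole at `0`,
`G(z) = (n + 1) / (2 n) * ∫_{|z|}^1 (1 - t²)^{n-1} t^{-2n+1} dt` (for `n ≥ 1` and `z ≠ 0`; the
value at the pole is immaterial, points being null sets). -/
def green {n : ℕ} (z : Cn n) : ℝ :=
  (n + 1) / (2 * n) * ∫ t in ‖z‖..1, (1 - t ^ 2) ^ (n - 1) / t ^ (2 * n - 1)

/-- The invariant measure `dg = dV / (1 - |z|²)^{n+1}` on the ball, `dV` being Lebesgue measure. -/
def invMeasure (n : ℕ) : Measure (Cn n) :=
  ((volume : Measure (Cn n)).restrict (unitBall n)).withDensity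
    (fun z => ENNReal.ofReal (1 / (1 - ‖z‖ ^ 2) ^ (n + 1)))

/-- The measure `dν = (n! / πⁿ) (Δ̃φ) G dg` on the ball. -/
def potentialMeasure {n : ℕ} (φ : Cn n → ℝ) : Measure (Cn n) :=
  (invMeasure n).withDensity
    (fun z => ENNReal.ofReal
      ((Nat.factorial n : ℝ) / Real.pi ^ n * (invLaplacian φ z * green z)))

/-- A Carleson measure on the ball: `μ(𝔹_n ∩ Q(ξ, r)) ≤ C rⁿ` for all `ξ ∈ 𝕊_n` and `r > 0`, where
`Q(ξ, r) = {z : |1 - ⟨z, ξ⟩| < r}` are the balls of the non-isotropic metric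
`|1 - ⟨z, ξ⟩|^{1/2}`, of radius `r^{1/2}`. -/
def IsCarleson {n : ℕ} (μ : Measure (Cn n)) : Prop :=
  ∃ C : ℝ≥0, ∀ ξ ∈ unitSphere n, ∀ r : ℝ, 0 < r →
    μ {z ∈ unitBall n | ‖1 - herm z ξ‖ < r} ≤ C * ENNReal.ofReal (r ^ n)

/-- `‖φ‖_∞`, the supremum of `|φ|` over the ball. -/
def supNormBall {n : ℕ} (φ : Cn n → ℝ) : ℝ := ⨆ z : unitBall n, |φ z|

end

end CarlesonBall

/-! The idea is to absorb `φ` into an exponential weight. Let `M > 0` bound `|φ|` and let `p` be a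
holomorphic polynomial. Every `∂̄_i` kills `p` and its holomorphic derivatives, so the invariant
Laplacian of `u = e^{φ/M} |p|²` is `e^{φ/M} |p|² Δ̃φ / M` plus a positive multiple of `|h|² - |∑ z_j
h_j|²`, where `h_j = p ∂_jφ / M + ∂_j p`. Cauchy-Schwarz makes the second term nonnegative in the
ball (`le_invLaplacian_exp_mul`). As `-1 ≤ φ/M ≤ 0`, this gives `|p|² Δ̃φ ≤ e M Δ̃u`, while `u ≤
|p|²`.

Formally, Green's formula says that the normalized integral of `Δ̃u` against `G dg` is the boundary
mean of `u` minus `u(0)`, hence at most the mean of `|p|²` over the sphere. Here `u` need not extend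
to the sphere and `G` has a pole, so the formula is proved for truncations of `G` compactly
supported in the ball (`integral_invLaplacian_mul_cutGreen`). The part of the cutoff near the origin
contributes with a favourable sign and is dropped; the part near the sphere yields the mean of
`|p|²` in the limit (`eventually_cut_bound`); Fatou's lemma removes the truncation
(`lintegral_invLaplacian_mul_green_le`).

To reach all of `H²`, polynomials approximating `f` in `L²(σ)` must converge pointwise in the ball
to its Cauchy-Szegő extension. This needs the Szegő formula for polynomials (`hardyExt_eq_eval`),
obtained from the sphere moments `integral_bimonomial`, and continuity of point evaluations
(`tendsto_hardyExt`). Fatou then gives `energy_hardyExt_le`. The Carleson condition follows by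
applying that inequality to a Szegő kernel with pole `(1 - min r 1) ξ`, which is large on the box of
radius `r` at `ξ`. -/

namespace CarlesonBall

noncomputable section

variable {n : ℕ}

/-! ### Calculus of the Wirtinger derivatives -/

section Wirtinger

lemma dz_congr {j : Fin n} {f g : Cn n → ℂ} {z : Cn n} (h : f =ᶠ[nhds z] g) :
    dz j f z = dz j g z := by
  simp only [dz, h.fderiv_eq]

lemma dzbar_congr {j : Fin n} {f g : Cn n → ℂ} {z : Cn n} (h : f =ᶠ[nhds z] g) :
    dzbar j f z = dzbar j g z := by
  simp only [dzbar, h.fderiv_eq]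

lemma dz_mul {j : Fin n} {f g : Cn n → ℂ} {z : Cn n} (hf : DifferentiableAt ℝ f z)
    (hg : DifferentiableAt ℝ g z) :
    dz j (fun w => f w * g w) z = dz j f z * g z + f z * dz j g z := by
  simp only [dz, fderiv_fun_mul hf hg, add_apply, smul_apply, smul_eq_mul]
  ring

lemma dzbar_mul {j : Fin n} {f g : Cn n → ℂ} {z : Cn n} (hf : DifferentiableAt ℝ f z)
    (hg : DifferentiableAt ℝ g z) :
    dzbar j (fun w => f w * g w) z = dzbar j f z * g z + f z * dzbar j g z := by
  simp only [dzbar, fderiv_fun_mul hf hg, add_apply, smul_apply, smul_eq_mul]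
  ring

lemma dzbar_add {j : Fin n} {f g : Cn n → ℂ} {z : Cn n} (hf : DifferentiableAt ℝ f z)
    (hg : DifferentiableAt ℝ g z) :
    dzbar j (fun w => f w + g w) z = dzbar j f z + dzbar j g z := by
  simp only [dzbar, fderiv_fun_add hf hg, add_apply]
  ring

lemma dzbar_const_sub {j : Fin n} {f : Cn n → ℂ} {z : Cn n} (c : ℂ) :
    dzbar j (fun w => c - f w) z = - dzbar j f z := by
  simp only [dzbar, fderiv_const_sub, neg_apply]
  ring

lemma dzbar_sum {ι : Type*} {s : Finset ι} {j : Fin n} {f : ι → Cn n → ℂ} {z : Cn n}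
    (hf : ∀ i ∈ s, DifferentiableAt ℝ (f i) z) :
    dzbar j (fun w => ∑ i ∈ s, f i w) z = ∑ i ∈ s, dzbar j (f i) z := by
  simp only [dzbar, fderiv_fun_sum hf, sum_apply, Finset.mul_sum, ← Finset.sum_add_distrib,
    Finset.sum_div]

lemma dz_eq_of_differentiableAt {j : Fin n} {f : Cn n → ℂ} {z : Cn n}
    (hf : DifferentiableAt ℂ f z) : dz j f z = fderiv ℂ f z (EuclideanSpace.single j 1) := by
  have h : EuclideanSpace.single j Complex.I
      = Complex.I • (EuclideanSpace.single j 1 : Cn n) := by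
    ext i; simp
  simp only [dz, hf.fderiv_restrictScalars ℝ, ContinuousLinearMap.coe_restrictScalars', h,
    map_smul, smul_eq_mul]
  linear_combination (-(fderiv ℂ f z) (EuclideanSpace.single j 1) / 2) * Complex.I_mul_I

lemma dzbar_eq_zero {j : Fin n} {f : Cn n → ℂ} {z : Cn n}
    (hf : DifferentiableAt ℂ f z) : dzbar j f z = 0 := by
  have h : EuclideanSpace.single j Complex.I
      = Complex.I • (EuclideanSpace.single j 1 : Cn n) := by
    ext i; simp
  simp only [dzbar, hf.fderiv_restrictScalars ℝ, ContinuousLinearMap.coe_restrictScalars', h,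
    map_smul, smul_eq_mul]
  linear_combination ((fderiv ℂ f z) (EuclideanSpace.single j 1) / 2) * Complex.I_mul_I

lemma fderiv_conj {f : Cn n → ℂ} {z : Cn n} (hf : DifferentiableAt ℝ f z) (v : Cn n) :
    fderiv ℝ (fun w => starRingEnd ℂ (f w)) z v = starRingEnd ℂ (fderiv ℝ f z v) := by
  have h := (Complex.conjCLE.toContinuousLinearMap.hasFDerivAt.comp z hf.hasFDerivAt).fderiv
  have h2 : (fun w => starRingEnd ℂ (f w)) = Complex.conjCLE.toContinuousLinearMap ∘ f := by
    ext w; simp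
  rw [h2, h]; simp

lemma dzbar_conj {j : Fin n} {f : Cn n → ℂ} {z : Cn n} (hf : DifferentiableAt ℝ f z) :
    dzbar j (fun w => starRingEnd ℂ (f w)) z = starRingEnd ℂ (dz j f z) := by
  simp [dzbar, dz, fderiv_conj hf, map_ofNat, sub_eq_add_neg]

lemma dz_conj {j : Fin n} {f : Cn n → ℂ} {z : Cn n} (hf : DifferentiableAt ℝ f z) :
    dz j (fun w => starRingEnd ℂ (f w)) z = starRingEnd ℂ (dzbar j f z) := by
  simp [dzbar, dz, fderiv_conj hf, map_ofNat, sub_eq_add_neg]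

lemma differentiableAt_coord (i : Fin n) (z : Cn n) : DifferentiableAt ℂ (fun w : Cn n => w i) z :=
  (EuclideanSpace.proj i : Cn n →L[ℂ] ℂ).differentiableAt

lemma contDiff_coord (i : Fin n) {k : WithTop ℕ∞} : ContDiff ℝ k (fun w : Cn n => w i) :=
  ((EuclideanSpace.proj i : Cn n →L[ℂ] ℂ).restrictScalars ℝ).contDiff

lemma contDiff_conj {k : WithTop ℕ∞} {f : Cn n → ℂ} {z : Cn n} (hf : ContDiffAt ℝ k f z) :
    ContDiffAt ℝ k (fun w => starRingEnd ℂ (f w)) z :=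
  Complex.conjCLE.contDiff.contDiffAt.comp z hf

lemma dz_coord (i j : Fin n) (z : Cn n) :
    dz j (fun w : Cn n => w i) z = if i = j then 1 else 0 := by
  rw [dz_eq_of_differentiableAt (differentiableAt_coord i z)]
  have := (EuclideanSpace.proj i : Cn n →L[ℂ] ℂ).fderiv (x := z)
  change fderiv ℂ (EuclideanSpace.proj i : Cn n →L[ℂ] ℂ) z _ = _
  rw [this]
  simp

lemma dzbar_coord (i j : Fin n) (z : Cn n) : dzbar j (fun w : Cn n => w i) z = 0 :=
  dzbar_eq_zero (differentiableAt_coord i z)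

lemma dzbar_conj_coord (i j : Fin n) (z : Cn n) :
    dzbar j (fun w : Cn n => starRingEnd ℂ (w i)) z = if i = j then 1 else 0 := by
  rw [dzbar_conj (contDiff_coord i (k := 1)).contDiffAt.differentiableAt_one, dz_coord]
  split_ifs <;> simp

/-- The derivative of a real function of `‖z‖²`. -/
lemma fderiv_radial {w : ℝ → ℝ} {z : Cn n} (hw : DifferentiableAt ℝ w (‖z‖ ^ 2)) (v : Cn n) :
    fderiv ℝ (fun z : Cn n => ((w (‖z‖ ^ 2) : ℝ) : ℂ)) z v
      = deriv w (‖z‖ ^ 2) * (2 * (inner ℂ z v).re : ℝ) := by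
  have h1 : HasFDerivAt (fun z : Cn n => ‖z‖ ^ 2) (2 • innerSL ℝ z) z :=
    (hasStrictFDerivAt_norm_sq z).hasFDerivAt
  have h2 := hw.hasDerivAt.comp_hasFDerivAt z h1
  have h3 := Complex.ofRealCLM.hasFDerivAt.comp z h2
  have h4 : (fun z : Cn n => ((w (‖z‖ ^ 2) : ℝ) : ℂ))
    = Complex.ofRealCLM ∘ (w ∘ fun z : Cn n => ‖z‖ ^ 2) := by ext; simp
  rw [h4, h3.fderiv]
  have : inner ℝ z v = (inner ℂ z v).re := by
    simp [PiLp.inner_apply, Complex.re_sum]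
  simp [this]

lemma dzbar_radial {w : ℝ → ℝ} {z : Cn n} (hw : DifferentiableAt ℝ w (‖z‖ ^ 2)) (j : Fin n) :
    dzbar j (fun z : Cn n => ((w (‖z‖ ^ 2) : ℝ) : ℂ)) z = deriv w (‖z‖ ^ 2) * z j := by
  rw [dzbar, fderiv_radial hw, fderiv_radial hw]
  simp only [EuclideanSpace.inner_single_right]
  apply Complex.ext <;> simp <;> ring

lemma dz_radial {w : ℝ → ℝ} {z : Cn n} (hw : DifferentiableAt ℝ w (‖z‖ ^ 2)) (j : Fin n) :
    dz j (fun z : Cn n => ((w (‖z‖ ^ 2) : ℝ) : ℂ)) z = deriv w (‖z‖ ^ 2) * starRingEnd ℂ (z j) := by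
  rw [dz, fderiv_radial hw, fderiv_radial hw]
  simp only [EuclideanSpace.inner_single_right]
  apply Complex.ext <;> simp <;> ring

lemma contDiff_radial {k : WithTop ℕ∞} {w : ℝ → ℝ} (hw : ContDiff ℝ k w) :
    ContDiff ℝ k (fun z : Cn n => ((w (‖z‖ ^ 2) : ℝ) : ℂ)) :=
  Complex.ofRealCLM.contDiff.comp (hw.comp (contDiff_norm_sq ℝ))

lemma contDiffAt_dz {k : WithTop ℕ∞} {u : Cn n → ℂ} {z : Cn n} (hu : ContDiffAt ℝ (k + 1) u z)
    (j : Fin n) : ContDiffAt ℝ k (dz j u) z := by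
  have h := hu.fderiv_right (m := k) le_rfl
  unfold dz
  exact ((h.clm_apply contDiffAt_const).sub
    (contDiffAt_const.mul (h.clm_apply contDiffAt_const))).div_const _

lemma contDiffAt_dzbar {k : WithTop ℕ∞} {u : Cn n → ℂ} {z : Cn n} (hu : ContDiffAt ℝ (k + 1) u z)
    (j : Fin n) : ContDiffAt ℝ k (dzbar j u) z := by
  have h := hu.fderiv_right (m := k) le_rfl
  unfold dzbar
  exact ((h.clm_apply contDiffAt_const).add
    (contDiffAt_const.mul (h.clm_apply contDiffAt_const))).div_const _

end Wirtinger

/-! ### Integrals of compactly supported divergences -/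

section Divergence

lemma integral_fderiv_eq_zero {F : Cn n → ℂ} (hF : ContDiff ℝ 1 F) (hs : HasCompactSupport F)
    (v : Cn n) : Integrable (fun z => fderiv ℝ F z v) ∧ ∫ z, fderiv ℝ F z v = 0 := by
  have hc : Continuous (fun z => fderiv ℝ F z v) :=
    (hF.continuous_fderiv one_ne_zero).clm_apply continuous_const
  have hi : Integrable (fun z => fderiv ℝ F z v) :=
    hc.integrable_of_hasCompactSupport (hs.fderiv_apply ℝ v)
  refine ⟨hi, ?_⟩
  have := integral_mul_fderiv_eq_neg_fderiv_mul_of_integrable (μ := (volume : Measure (Cn n)))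
    (f := fun _ => (1 : ℂ)) (g := F) (v := v) (by simp) (by simpa using hi)
    (by simpa using hF.continuous.integrable_of_hasCompactSupport hs)
    (fun x _ => differentiableAt_const _) (fun x _ => hF.contDiffAt.differentiableAt_one)
  simpa using this

/-- Functions such as `φ` are regular only inside the ball, with arbitrary values outside.
Multiplying by a weight that dies before the sphere makes them globally `C¹`, so integration by
parts on the whole space applies and no boundary terms appear. -/
lemma contDiff_of_vanish {F : Cn n → ℂ} {ρ : ℝ} (hρ : ρ < 1)
    (hF : ∀ z ∈ unitBall n, ContDiffAt ℝ 1 F z) (h0 : ∀ z : Cn n, ρ ≤ ‖z‖ → F z = 0) :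
    ContDiff ℝ 1 F ∧ HasCompactSupport F := by
  constructor
  · rw [contDiff_iff_contDiffAt]
    intro z
    by_cases hz : ‖z‖ < 1
    · exact hF z (by simpa using hz)
    · have : F =ᶠ[nhds z] fun _ => 0 := by
        filter_upwards [(isOpen_lt continuous_const continuous_norm).mem_nhds
          (show ρ < ‖z‖ by linarith)] with w hw
        exact h0 w (le_of_lt hw)
      exact contDiffAt_const.congr_of_eventuallyEq this
  · refine HasCompactSupport.intro (isCompact_closedBall (0 : Cn n) ρ) ?_
    intro z hz
    exact h0 z (by simp at hz; exact hz.le)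

lemma integral_dz_eq_zero {F : Cn n → ℂ} {ρ : ℝ} (hρ : ρ < 1)
    (hF : ∀ z ∈ unitBall n, ContDiffAt ℝ 1 F z) (h0 : ∀ z : Cn n, ρ ≤ ‖z‖ → F z = 0)
    (j : Fin n) : Integrable (dz j F) ∧ ∫ z, dz j F z = 0 := by
  obtain ⟨h1, h2⟩ := contDiff_of_vanish hρ hF h0
  obtain ⟨a, a'⟩ := integral_fderiv_eq_zero h1 h2 (EuclideanSpace.single j 1)
  obtain ⟨b, b'⟩ := integral_fderiv_eq_zero h1 h2 (EuclideanSpace.single j Complex.I)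
  refine ⟨(a.sub (b.const_mul _)).div_const _, ?_⟩
  simp only [dz]
  rw [integral_div, integral_sub a (b.const_mul _), integral_const_mul, a', b']
  simp

lemma integral_dzbar_eq_zero {F : Cn n → ℂ} {ρ : ℝ} (hρ : ρ < 1)
    (hF : ∀ z ∈ unitBall n, ContDiffAt ℝ 1 F z) (h0 : ∀ z : Cn n, ρ ≤ ‖z‖ → F z = 0)
    (j : Fin n) : Integrable (dzbar j F) ∧ ∫ z, dzbar j F z = 0 := by
  obtain ⟨h1, h2⟩ := contDiff_of_vanish hρ hF h0
  obtain ⟨a, a'⟩ := integral_fderiv_eq_zero h1 h2 (EuclideanSpace.single j 1)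
  obtain ⟨b, b'⟩ := integral_fderiv_eq_zero h1 h2 (EuclideanSpace.single j Complex.I)
  refine ⟨(a.add (b.const_mul _)).div_const _, ?_⟩
  simp only [dzbar]
  rw [integral_div, integral_add a (b.const_mul _), integral_const_mul, a', b']
  simp

end Divergence

/-! ### Two integrations by parts against a radial weight -/

section GreenIdentity

/-- The vector field `∑ j, (δ_{ij} - conj (z_i) z_j) w(‖z‖²) ∂_j u`. -/
def greenField (u : Cn n → ℂ) (w : ℝ → ℝ) (i : Fin n) (z : Cn n) : ℂ :=
  ∑ j, (((if i = j then 1 else 0) - starRingEnd ℂ (z i) * z j) * (w (‖z‖ ^ 2) : ℂ)) * dz j u z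

lemma sum_conj_mul_self (z : Cn n) : ∑ i, starRingEnd ℂ (z i) * z i = ((‖z‖ ^ 2 : ℝ) : ℂ) := by
  rw [EuclideanSpace.norm_sq_eq]
  push_cast
  refine Finset.sum_congr rfl fun i _ => ?_
  rw [mul_comm, Complex.mul_conj, Complex.normSq_eq_norm_sq]
  push_cast; rfl

lemma contDiffAt_greenField {u : Cn n → ℂ} {w : ℝ → ℝ} {z : Cn n} (hu : ContDiffAt ℝ 2 u z)
    (hw : ContDiff ℝ 1 w) (i : Fin n) : ContDiffAt ℝ 1 (greenField u w i) z := by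
  unfold greenField
  refine ContDiffAt.sum fun j _ => ?_
  refine ContDiffAt.mul (ContDiffAt.mul ?_ (contDiff_radial hw).contDiffAt)
    (contDiffAt_dz (by rwa [one_add_one_eq_two]) j)
  exact contDiffAt_const.sub ((contDiff_conj (contDiff_coord i).contDiffAt).mul
    (contDiff_coord j).contDiffAt)

lemma dzbar_greenField {u : Cn n → ℂ} {w : ℝ → ℝ} {z : Cn n} (hu : ContDiffAt ℝ 2 u z)
    (hw : ContDiff ℝ 1 w) (i : Fin n) :
    dzbar i (greenField u w i) z = ∑ j,
      ((-z j * w (‖z‖ ^ 2) + ((if i = j then 1 else 0) - starRingEnd ℂ (z i) * z j)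
          * ((deriv w (‖z‖ ^ 2) : ℝ) * z i)) * dz j u z
        + ((if i = j then 1 else 0) - starRingEnd ℂ (z i) * z j) * w (‖z‖ ^ 2)
          * dzbar i (dz j u) z) := by
  have hd : ∀ j, DifferentiableAt ℝ (fun z : Cn n => starRingEnd ℂ (z i) * z j) z := fun j =>
    ((contDiff_conj (contDiff_coord (k := 1) i).contDiffAt).mul
      (contDiff_coord j).contDiffAt).differentiableAt_one
  have hr : DifferentiableAt ℝ (fun z : Cn n => ((w (‖z‖ ^ 2) : ℝ) : ℂ)) z :=
    (contDiff_radial hw).contDiffAt.differentiableAt_one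
  have hdz : ∀ j, DifferentiableAt ℝ (dz j u) z := fun j =>
    (contDiffAt_dz (k := 1) (by rwa [one_add_one_eq_two]) j).differentiableAt_one
  unfold greenField
  rw [dzbar_sum]
  · refine Finset.sum_congr rfl fun j _ => ?_
    rw [dzbar_mul (((differentiableAt_const _).fun_sub (hd j)).fun_mul hr) (hdz j),
      dzbar_mul ((differentiableAt_const _).fun_sub (hd j)) hr,
      dzbar_const_sub, dzbar_mul
        (contDiff_conj (contDiff_coord (k := 1) i).contDiffAt).differentiableAt_one
        (contDiff_coord (k := 1) j).contDiffAt.differentiableAt_one, dzbar_coord,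
      dzbar_conj_coord, dzbar_radial hw.contDiffAt.differentiableAt_one]
    simp
  · intro j _
    exact (((differentiableAt_const _).fun_sub (hd j)).fun_mul hr).fun_mul (hdz j)

/-- The first-order terms collapse to a radial multiple of the holomorphic Euler field `∑ z_j ∂_j`,
because `∑_i (δ_{ij} - conj (z_i) z_j) z_i = (1 - |z|²) z_j`, while differentiating the `n`
coefficients `conj (z_i) z_j` produces `-n w z_j`. -/
lemma sum_dzbar_greenField {u : Cn n → ℂ} {w Q : ℝ → ℝ} {z : Cn n} (hu : ContDiffAt ℝ 2 u z)
    (hw : ContDiff ℝ 1 w) (hwQ : ∀ s, (1 - s) * deriv w s - n * w s = Q s) :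
    ∑ i, dzbar i (greenField u w i) z = ∑ j, z j * Q (‖z‖ ^ 2) * dz j u z
      + w (‖z‖ ^ 2) * ∑ i, ∑ j, ((if i = j then 1 else 0) - starRingEnd ℂ (z i) * z j)
          * dzbar i (dz j u) z := by
  simp only [dzbar_greenField hu hw]
  simp only [Finset.sum_add_distrib]
  congr 1
  · rw [Finset.sum_comm]
    refine Finset.sum_congr rfl fun j _ => ?_
    rw [← Finset.sum_mul, Finset.sum_add_distrib]
    congr 1
    have h1 : ∑ i, ((if i = j then 1 else 0) - starRingEnd ℂ (z i) * z j)
        * ((deriv w (‖z‖ ^ 2) : ℝ) * z i)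
        = (deriv w (‖z‖ ^ 2) : ℝ) * z j - (deriv w (‖z‖ ^ 2) : ℝ) * z j * ∑ i, starRingEnd ℂ (z i) * z i := by
      simp only [sub_mul, Finset.sum_sub_distrib, ite_mul, one_mul, zero_mul,
        Finset.sum_ite_eq', Finset.mem_univ, if_true, Finset.mul_sum]
      congr 1
      exact Finset.sum_congr rfl fun i _ => by ring
    rw [h1, sum_conj_mul_self, ← hwQ]
    simp
    ring
  · rw [Finset.mul_sum]
    refine Finset.sum_congr rfl fun i _ => ?_
    rw [Finset.mul_sum]
    exact Finset.sum_congr rfl fun j _ => by ring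

/-- This moves the Euler field off `u`: the field `z_j` has divergence `n`, and `∑ z_j ∂_j` acts on
a function of `s = |z|²` as `s d/ds`. -/
lemma sum_dz_mul_radial {u : Cn n → ℂ} {Q : ℝ → ℝ} {z : Cn n} (hu : ContDiffAt ℝ 2 u z)
    (hQ : ContDiff ℝ 1 Q) :
    ∑ j, dz j (fun z => z j * Q (‖z‖ ^ 2) * u z) z = ∑ j, z j * Q (‖z‖ ^ 2) * dz j u z
      + u z * ((n * Q (‖z‖ ^ 2) + ‖z‖ ^ 2 * deriv Q (‖z‖ ^ 2) : ℝ) : ℂ) := by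
  have hc : ∀ j, DifferentiableAt ℝ (fun z : Cn n => z j) z := fun j =>
    (contDiff_coord (k := 1) j).contDiffAt.differentiableAt_one
  have hr : DifferentiableAt ℝ (fun z : Cn n => ((Q (‖z‖ ^ 2) : ℝ) : ℂ)) z :=
    (contDiff_radial hQ).contDiffAt.differentiableAt_one
  have h : ∀ j, dz j (fun z => z j * Q (‖z‖ ^ 2) * u z) z
      = z j * Q (‖z‖ ^ 2) * dz j u z + (u z * Q (‖z‖ ^ 2)
        + u z * (deriv Q (‖z‖ ^ 2) : ℝ) * (starRingEnd ℂ (z j) * z j)) := by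
    intro j
    rw [dz_mul ((hc j).fun_mul hr) (hu.differentiableAt (by simp)), dz_mul (hc j) hr, dz_coord,
      dz_radial hQ.contDiffAt.differentiableAt_one]
    simp
    ring
  simp only [h, Finset.sum_add_distrib, ← Finset.mul_sum, sum_conj_mul_self]
  simp
  ring

/-- Green's identity for the operator `∑_{ij} (δ_{ij} - conj (z_i) z_j) ∂̄_i ∂_j` and a radial
weight: the adjoint operator sends `w(‖z‖²)` to `(n Q + s Q')(‖z‖²)`, `Q = (1 - s) w' - n w`. -/
theorem integral_radial_mul_eq {u : Cn n → ℂ} {w Q : ℝ → ℝ} {ρ : ℝ} (h0ρ : 0 ≤ ρ) (hρ : ρ < 1)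
    (hu : ∀ z ∈ unitBall n, ContDiffAt ℝ 2 u z)
    (hw : ContDiff ℝ 1 w) (hQ : ContDiff ℝ 1 Q)
    (hw0 : ∀ s, ρ ^ 2 ≤ s → w s = 0) (hQ0 : ∀ s, ρ ^ 2 ≤ s → Q s = 0)
    (hwQ : ∀ s, (1 - s) * deriv w s - n * w s = Q s) :
    Integrable (fun z : Cn n => w (‖z‖ ^ 2) * ∑ i, ∑ j,
        ((if i = j then 1 else 0) - starRingEnd ℂ (z i) * z j) * dzbar i (dz j u) z) ∧
    ∫ z, w (‖z‖ ^ 2) * ∑ i, ∑ j, ((if i = j then 1 else 0) - starRingEnd ℂ (z i) * z j)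
          * dzbar i (dz j u) z
      = ∫ z, u z * ((n * Q (‖z‖ ^ 2) + ‖z‖ ^ 2 * deriv Q (‖z‖ ^ 2) : ℝ) : ℂ) := by
  have hsq : ∀ z : Cn n, ρ ≤ ‖z‖ → ρ ^ 2 ≤ ‖z‖ ^ 2 := fun z hz => by gcongr
  have hF := fun i => integral_dzbar_eq_zero (F := greenField u w i) hρ
    (fun z hz => contDiffAt_greenField (hu z hz) hw i)
    (fun z hz => by simp [greenField, hw0 _ (hsq z hz)]) i
  have hH := fun j => integral_dz_eq_zero (F := fun z => z j * Q (‖z‖ ^ 2) * u z) hρ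
    (fun z hz => ((contDiff_coord j).contDiffAt.mul (contDiff_radial hQ).contDiffAt).mul
      ((hu z hz).of_le (by norm_num)))
    (fun z hz => by simp [hQ0 _ (hsq z hz)]) j
  -- The integrand differs from its adjoint form by two divergences. Where `|z| ≥ 1 > ρ`, nothing is
  -- known about `u`, but all weights vanish near `z`.
  have hpt : ∀ z : Cn n, w (‖z‖ ^ 2) * ∑ i, ∑ j,
        ((if i = j then 1 else 0) - starRingEnd ℂ (z i) * z j) * dzbar i (dz j u) z
      = (∑ i, dzbar i (greenField u w i) z - ∑ j, dz j (fun z => z j * Q (‖z‖ ^ 2) * u z) z)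
        + u z * ((n * Q (‖z‖ ^ 2) + ‖z‖ ^ 2 * deriv Q (‖z‖ ^ 2) : ℝ) : ℂ) := by
    intro z
    by_cases hz : ‖z‖ < 1
    · have hz' := hu z (by simpa using hz)
      rw [sum_dzbar_greenField hz' hw hwQ, sum_dz_mul_radial hz' hQ]
      ring
    · have hρz : ρ < ‖z‖ := by linarith
      have hev : ∀ᶠ y : Cn n in nhds z, ρ ≤ ‖y‖ := by
        filter_upwards [(isOpen_lt continuous_const continuous_norm).mem_nhds hρz] with y hy
        exact le_of_lt hy
      have h1 : ∀ i, dzbar i (greenField u w i) z = 0 := by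
        intro i
        rw [dzbar_congr (g := fun _ => 0)]
        · simp [dzbar]
        · filter_upwards [hev] with y hy
          simp [greenField, hw0 _ (hsq y hy)]
      have h2 : ∀ j, dz j (fun z => z j * Q (‖z‖ ^ 2) * u z) z = 0 := by
        intro i
        rw [dz_congr (g := fun _ => 0)]
        · simp [dz]
        · filter_upwards [hev] with y hy
          simp [hQ0 _ (hsq y hy)]
      have h3 : deriv Q (‖z‖ ^ 2) = 0 := by
        have : Q =ᶠ[nhds (‖z‖ ^ 2)] fun _ => 0 := by
          filter_upwards [(isOpen_lt continuous_const continuous_id).mem_nhds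
            (show ρ ^ 2 < ‖z‖ ^ 2 by gcongr)] with y hy
          exact hQ0 y (le_of_lt hy)
        rw [this.deriv_eq]; simp
      simp [h1, h2, h3, hw0 _ (hsq z hρz.le), hQ0 _ (hsq z hρz.le)]
  have hI : Integrable (fun z : Cn n =>
      u z * ((n * Q (‖z‖ ^ 2) + ‖z‖ ^ 2 * deriv Q (‖z‖ ^ 2) : ℝ) : ℂ)) := by
    have hzero : ∀ s, ρ ^ 2 < s → n * Q s + s * deriv Q s = 0 := by
      intro s hs
      have : Q =ᶠ[nhds s] fun _ => 0 := by
        filter_upwards [(isOpen_lt continuous_const continuous_id).mem_nhds hs] with y hy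
        exact hQ0 y (le_of_lt hy)
      rw [this.deriv_eq, hQ0 s hs.le]; simp
    have hcc : Continuous fun z : Cn n => ((n * Q (‖z‖ ^ 2) + ‖z‖ ^ 2 * deriv Q (‖z‖ ^ 2) : ℝ) : ℂ) := by
      have h1 := hQ.continuous
      have h2 := hQ.continuous_deriv_one
      fun_prop
    have hc : ContinuousOn (fun z : Cn n =>
      u z * ((n * Q (‖z‖ ^ 2) + ‖z‖ ^ 2 * deriv Q (‖z‖ ^ 2) : ℝ) : ℂ)) (closedBall 0 ρ) := by
      intro z hz
      refine ((hu z ?_).continuousAt.mul hcc.continuousAt).continuousWithinAt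
      simp at hz ⊢; linarith
    have := hc.integrableOn_compact (μ := volume) (isCompact_closedBall (0 : Cn n) ρ)
    rw [← integrableOn_iff_integrable_of_support_subset (s := closedBall 0 ρ)]
    · exact this
    · intro z hz
      by_contra hcon
      simp only [mem_closedBall, dist_zero_right, not_le] at hcon
      apply hz
      simp only
      rw [hzero _ (by gcongr)]
      simp
  simp only [hpt]
  have e1 : Integrable (fun z : Cn n => ∑ i, dzbar i (greenField u w i) z) :=
    integrable_finsetSum _ fun i _ => (hF i).1
  have e2 : Integrable (fun z : Cn n => ∑ j, dz j (fun z => z j * Q (‖z‖ ^ 2) * u z) z) :=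
    integrable_finsetSum _ fun j _ => (hH j).1
  have e3 : Integrable (fun z : Cn n => ∑ i, dzbar i (greenField u w i) z
      - ∑ j, dz j (fun z => z j * Q (‖z‖ ^ 2) * u z) z) := e1.sub e2
  refine ⟨e3.add hI, ?_⟩
  rw [integral_add e3 hI, integral_sub e1 e2, integral_finsetSum _ fun i _ => (hF i).1,
    integral_finsetSum _ fun i _ => (hH i).1]
  simp [hF, hH]

end GreenIdentity

/-! ### The invariant Laplacian of an exponential weight times `|p|²` -/

section Laplacian

lemma dz_cexp {j : Fin n} {g : Cn n → ℂ} {z : Cn n} (hg : DifferentiableAt ℝ g z) :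
    dz j (fun w => Complex.exp (g w)) z = Complex.exp (g z) * dz j g z := by
  simp only [dz, hg.hasFDerivAt.cexp.fderiv, smul_apply, smul_eq_mul]
  ring

lemma dzbar_cexp {j : Fin n} {g : Cn n → ℂ} {z : Cn n} (hg : DifferentiableAt ℝ g z) :
    dzbar j (fun w => Complex.exp (g w)) z = Complex.exp (g z) * dzbar j g z := by
  simp only [dzbar, hg.hasFDerivAt.cexp.fderiv, smul_apply, smul_eq_mul]
  ring

lemma contDiffAt_ofReal {φ : Cn n → ℝ} {z : Cn n} {k : WithTop ℕ∞} (h : ContDiffAt ℝ k φ z) :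
    ContDiffAt ℝ k (fun w => (φ w : ℂ)) z :=
  Complex.ofRealCLM.contDiff.contDiffAt.comp z h

lemma dzbar_ofReal {j : Fin n} {φ : Cn n → ℝ} {z : Cn n} (h : DifferentiableAt ℝ φ z) :
    dzbar j (fun w => (φ w : ℂ)) z = starRingEnd ℂ (dz j (fun w => (φ w : ℂ)) z) := by
  have h1 : DifferentiableAt ℝ (fun w => (φ w : ℂ)) z :=
    Complex.ofRealCLM.differentiableAt.comp z h
  rw [← dzbar_conj h1]
  simp

lemma contDiff_dz_of_holomorphic {p : Cn n → ℂ} (hp : ContDiff ℂ 2 p) (j : Fin n) :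
    ContDiff ℂ 1 (dz j p) := by
  have h : dz j p = fun z => fderiv ℂ p z (EuclideanSpace.single j 1) := by
    ext z
    exact dz_eq_of_differentiableAt (hp.differentiable (by simp) z)
  rw [h]
  exact (hp.fderiv_right (m := 1) (by rw [one_add_one_eq_two])).clm_apply contDiff_const

lemma dz_exp_mul {φ : Cn n → ℝ} {p : Cn n → ℂ} {z : Cn n} (hφ : ContDiffAt ℝ 1 φ z)
    (hp : Differentiable ℂ p) (j : Fin n) :
    dz j (fun w => Complex.exp (φ w) * (p w * starRingEnd ℂ (p w))) z
      = Complex.exp (φ z) * (starRingEnd ℂ (p z)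
        * (p z * dz j (fun w => (φ w : ℂ)) z + dz j p z)) := by
  have h1 : DifferentiableAt ℝ (fun w => (φ w : ℂ)) z :=
    (contDiffAt_ofReal hφ).differentiableAt_one
  have h2 : DifferentiableAt ℝ p z := (hp z).restrictScalars ℝ
  have h3 : DifferentiableAt ℝ (fun w => starRingEnd ℂ (p w)) z :=
    Complex.conjCLE.differentiableAt.comp z h2
  rw [dz_mul h1.cexp (h2.fun_mul h3), dz_mul h2 h3, dz_cexp h1, dz_conj h2, dzbar_eq_zero (hp z)]
  simp
  ring

/-- Completing the square: with `h_j = p ∂_jφ + ∂_j p`, all terms without second derivatives of `φ`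
assemble into the rank-one matrix `conj (h_i) h_j`. Reality of `φ` enters through `∂̄_i φ = conj
(∂_i φ)`. -/
lemma dzbar_dz_exp_mul {φ : Cn n → ℝ} {p : Cn n → ℂ} {z : Cn n} (hφ : ContDiffAt ℝ 2 φ z)
    (hp : ContDiff ℂ 2 p) (i j : Fin n) :
    dzbar i (dz j (fun w => Complex.exp (φ w) * (p w * starRingEnd ℂ (p w)))) z
      = Complex.exp (φ z) * (starRingEnd ℂ (p z * dz i (fun w => (φ w : ℂ)) z + dz i p z)
          * (p z * dz j (fun w => (φ w : ℂ)) z + dz j p z))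
        + Complex.exp (φ z) * (p z * starRingEnd ℂ (p z))
          * dzbar i (dz j (fun w => (φ w : ℂ))) z := by
  have hpd : Differentiable ℂ p := hp.differentiable (by simp)
  have hev : dz j (fun w => Complex.exp (φ w) * (p w * starRingEnd ℂ (p w))) =ᶠ[nhds z]
      fun w => Complex.exp (φ w) * (starRingEnd ℂ (p w)
        * (p w * dz j (fun w => (φ w : ℂ)) w + dz j p w)) := by
    filter_upwards [hφ.eventually (by simp)] with w hw
    exact dz_exp_mul (hw.of_le (by norm_num)) hpd j
  rw [dzbar_congr hev]
  have h1 : DifferentiableAt ℝ (fun w => (φ w : ℂ)) z :=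
    (contDiffAt_ofReal hφ).differentiableAt (by simp)
  have h2 : DifferentiableAt ℝ p z := (hpd z).restrictScalars ℝ
  have h3 : DifferentiableAt ℝ (fun w => starRingEnd ℂ (p w)) z :=
    Complex.conjCLE.differentiableAt.comp z h2
  have h4 : DifferentiableAt ℝ (dz j (fun w => (φ w : ℂ))) z :=
    (contDiffAt_dz (k := 1) (by rw [one_add_one_eq_two]; exact contDiffAt_ofReal hφ)
      j).differentiableAt_one
  have h5 : DifferentiableAt ℂ (dz j p) z :=
    (contDiff_dz_of_holomorphic hp j).contDiffAt.differentiableAt_one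
  have h6 : DifferentiableAt ℝ (dz j p) z := h5.restrictScalars ℝ
  rw [dzbar_mul h1.cexp (h3.fun_mul ((h2.fun_mul h4).fun_add h6)),
    dzbar_mul h3 ((h2.fun_mul h4).fun_add h6), dzbar_add (h2.fun_mul h4) h6, dzbar_mul h2 h4,
    dzbar_cexp h1, dzbar_conj h2, dzbar_eq_zero (hpd z), dzbar_eq_zero h5,
    dzbar_ofReal (hφ.differentiableAt (by simp))]
  simp
  ring

/-- The sum `∑_{ij} (δ_{ij} - conj (z_i) z_j) a_{ij}`. -/
def contractInv (z : Cn n) (a : Fin n → Fin n → ℂ) : ℂ :=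
  ∑ i, ∑ j, ((if i = j then 1 else 0) - starRingEnd ℂ (z i) * z j) * a i j

lemma invLaplacianC_eq (u : Cn n → ℂ) (z : Cn n) : invLaplacianC u z
    = ((4 * (1 - ‖z‖ ^ 2) / (n + 1) : ℝ) : ℂ) * contractInv z fun i j => dzbar i (dz j u) z := by
  simp only [invLaplacianC, bergmanInv, contractInv, Finset.mul_sum]
  refine Finset.sum_congr rfl fun i _ => Finset.sum_congr rfl fun j _ => ?_
  push_cast
  ring

lemma contractInv_add_mul (z : Cn n) (a b : Fin n → Fin n → ℂ) (c d : ℂ) :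
    contractInv z (fun i j => c * a i j + d * b i j)
      = c * contractInv z a + d * contractInv z b := by
  simp only [contractInv, Finset.mul_sum, ← Finset.sum_add_distrib]
  refine Finset.sum_congr rfl fun i _ => Finset.sum_congr rfl fun j _ => ?_
  ring

/-- This makes the positivity of the inverse Bergman metric visible: by `norm_sum_mul_le` the right
side is at least `(1 - |z|²) |h|²`. -/
lemma contractInv_conj_mul (z h : Cn n) :
    contractInv z (fun i j => starRingEnd ℂ (h i) * h j)
      = ((‖h‖ ^ 2 - ‖∑ j, z j * h j‖ ^ 2 : ℝ) : ℂ) := by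
  have h1 : contractInv z (fun i j => starRingEnd ℂ (h i) * h j)
      = ∑ i, starRingEnd ℂ (h i) * h i - starRingEnd ℂ (∑ j, z j * h j) * ∑ j, z j * h j := by
    simp only [contractInv, sub_mul, Finset.sum_sub_distrib, ite_mul, one_mul, zero_mul,
      Finset.sum_ite_eq, Finset.mem_univ, if_true]
    congr 1
    rw [map_sum, Finset.sum_mul_sum]
    refine Finset.sum_congr rfl fun i _ => Finset.sum_congr rfl fun j _ => ?_
    rw [map_mul]
    ring
  rw [h1, sum_conj_mul_self, mul_comm (starRingEnd ℂ _), Complex.mul_conj,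
    Complex.normSq_eq_norm_sq]
  push_cast
  rfl

lemma norm_sum_mul_le (z h : Cn n) : ‖∑ j, z j * h j‖ ≤ ‖z‖ * ‖h‖ := by
  rw [EuclideanSpace.norm_eq, EuclideanSpace.norm_eq]
  refine (norm_sum_le _ _).trans ?_
  simp only [norm_mul]
  exact Real.sum_mul_le_sqrt_mul_sqrt _ _ _

/-- The invariant Laplacian of `e^φ |p|²` for `p` holomorphic. -/
lemma le_invLaplacian_exp_mul {φ : Cn n → ℝ} {p : Cn n → ℂ} {z : Cn n} (hz : z ∈ unitBall n)
    (hφ : ContDiffAt ℝ 2 φ z) (hp : ContDiff ℂ 2 p) :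
    Real.exp (φ z) * ‖p z‖ ^ 2 * invLaplacian φ z
      ≤ invLaplacian (fun w => Real.exp (φ w) * ‖p w‖ ^ 2) z := by
  have hz1 : ‖z‖ < 1 := by simpa using hz
  have hz2 : ‖z‖ ^ 2 ≤ 1 := by nlinarith [norm_nonneg z]
  set h : Cn n := WithLp.toLp 2 fun j => p z * dz j (fun w => (φ w : ℂ)) z + dz j p z with hh
  have e1 : (fun w => ((Real.exp (φ w) * ‖p w‖ ^ 2 : ℝ) : ℂ))
      = fun w => Complex.exp (φ w) * (p w * starRingEnd ℂ (p w)) := by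
    ext w
    rw [Complex.mul_conj, Complex.normSq_eq_norm_sq]
    push_cast
    rfl
  have e2 : invLaplacianC (fun w => ((Real.exp (φ w) * ‖p w‖ ^ 2 : ℝ) : ℂ)) z
      = ((4 * (1 - ‖z‖ ^ 2) / (n + 1) * Real.exp (φ z)
          * (‖h‖ ^ 2 - ‖∑ j, z j * h j‖ ^ 2) : ℝ) : ℂ)
        + ((Real.exp (φ z) * ‖p z‖ ^ 2 : ℝ) : ℂ) * invLaplacianC (fun w => (φ w : ℂ)) z := by
    rw [invLaplacianC_eq, invLaplacianC_eq, e1]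
    simp only [dzbar_dz_exp_mul hφ hp]
    rw [contractInv_add_mul z (fun i j => starRingEnd ℂ (h i) * h j), contractInv_conj_mul,
      Complex.mul_conj, Complex.normSq_eq_norm_sq]
    push_cast
    ring
  rw [invLaplacian, invLaplacian, e2, Complex.add_re, Complex.re_ofReal_mul, Complex.ofReal_re]
  have h3 := norm_sum_mul_le z h
  have h4 : ‖∑ j, z j * h j‖ ^ 2 ≤ ‖h‖ ^ 2 := by
    have : ‖∑ j, z j * h j‖ ≤ ‖h‖ := h3.trans (by nlinarith [norm_nonneg h])
    gcongr
  have h5 : 0 ≤ 4 * (1 - ‖z‖ ^ 2) / (n + 1) * Real.exp (φ z)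
          * (‖h‖ ^ 2 - ‖∑ j, z j * h j‖ ^ 2) := by
    have a1 : 0 ≤ 1 - ‖z‖ ^ 2 := by linarith
    have a2 : 0 ≤ ‖h‖ ^ 2 - ‖∑ j, z j * h j‖ ^ 2 := by linarith
    positivity
  linarith

lemma invLaplacian_const_mul {φ : Cn n → ℝ} {z : Cn n} (c : ℝ) (hφ : ContDiffAt ℝ 2 φ z) :
    invLaplacian (fun w => c * φ w) z = c * invLaplacian φ z := by
  have h1 : ∀ j : Fin n, dz j (fun w => ((c * φ w : ℝ) : ℂ)) =ᶠ[nhds z]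
      fun w => c * dz j (fun w => (φ w : ℂ)) w := by
    intro j
    filter_upwards [hφ.eventually (by simp)] with w hw
    have := dz_mul (j := j) (f := fun _ => (c : ℂ)) (differentiableAt_const _)
      ((contDiffAt_ofReal hw).differentiableAt (by simp))
    simp only [Complex.ofReal_mul]
    rw [this]
    simp [dz]
  have h2 : ∀ i j : Fin n, dzbar i (dz j (fun w => ((c * φ w : ℝ) : ℂ))) z
      = c * dzbar i (dz j (fun w => (φ w : ℂ))) z + 0 * 0 := by
    intro i j
    rw [dzbar_congr (h1 j)]
    have h4 : DifferentiableAt ℝ (dz j (fun w => (φ w : ℂ))) z :=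
      (contDiffAt_dz (k := 1) (by rw [one_add_one_eq_two]; exact contDiffAt_ofReal hφ)
        j).differentiableAt_one
    rw [dzbar_mul (f := fun _ => (c : ℂ)) (differentiableAt_const _) h4]
    simp [dzbar]
  rw [invLaplacian, invLaplacian, invLaplacianC_eq, invLaplacianC_eq]
  simp only [h2]
  rw [contractInv_add_mul z _ (fun _ _ => 0), zero_mul, add_zero, mul_left_comm,
    Complex.re_ofReal_mul]

lemma continuousOn_invLaplacian {φ : Cn n → ℝ} (hφ : ContDiffOn ℝ 2 φ (unitBall n)) :
    ContinuousOn (invLaplacian φ) (unitBall n) := by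
  intro z hz
  have hφz : ContDiffAt ℝ 2 φ z := hφ.contDiffAt (isOpen_ball.mem_nhds hz)
  have h : ∀ i j : Fin n, ContinuousAt (dzbar i (dz j (fun w => (φ w : ℂ)))) z := fun i j =>
    (contDiffAt_dzbar (k := 0) (contDiffAt_dz (by
      rw [zero_add, one_add_one_eq_two]; exact contDiffAt_ofReal hφz) j) i).continuousAt
  apply ContinuousAt.continuousWithinAt
  unfold invLaplacian
  simp only [invLaplacianC_eq, contractInv]
  have hc : ∀ i : Fin n, Continuous fun z : Cn n => z i := fun i =>
    (contDiff_coord (k := 0) i).continuous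
  apply Complex.continuous_re.continuousAt.comp
  refine ContinuousAt.mul (by fun_prop) ?_
  refine tendsto_finsetSum _ fun i _ => tendsto_finsetSum _ fun j _ => ?_
  refine ContinuousAt.mul (Continuous.continuousAt ?_) (h i j)
  have := hc i
  have := hc j
  have := Complex.continuous_conj
  fun_prop

end Laplacian

/-! ### Truncated Green functions and Green's formula -/

section Weights

lemma contDiff_mul_of_vanish_left {m g : ℝ → ℝ} {a : ℝ} (ha : 0 < a) {k : WithTop ℕ∞}
    (hm : ContDiff ℝ k m) (hm0 : ∀ s ≤ a, m s = 0) (hg : ∀ s, s ≠ 0 → ContDiffAt ℝ k g s) :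
    ContDiff ℝ k fun s => m s * g s := by
  rw [contDiff_iff_contDiffAt]
  intro s
  by_cases hs : s < a
  · have : (fun s => m s * g s) =ᶠ[nhds s] fun _ => 0 := by
      filter_upwards [(isOpen_lt continuous_id continuous_const).mem_nhds hs] with y hy
      rw [hm0 y (le_of_lt hy), zero_mul]
    exact contDiffAt_const.congr_of_eventuallyEq this
  · exact hm.contDiffAt.mul (hg s (by intro h; apply hs; rw [h]; exact ha))

/-- The truncation of Green's function, as a function of `s = ‖z‖²`, by the cutoff `m`. -/
def cutGreen (n : ℕ) (m : ℝ → ℝ) (s : ℝ) : ℝ :=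
  (n + 1) / (4 * n) * ∫ x in s..1, m x * ((1 - x) ^ (n - 1) / x ^ n)

/-- A `C¹` cutoff function, vanishing outside of a compact subset of `(0, 1)`. -/
structure IsCutoff (m : ℝ → ℝ) (a b : ℝ) : Prop where
  contDiff : ContDiff ℝ 1 m
  pos : 0 < a
  lt_one : b < 1
  nonneg : 0 ≤ b
  left : ∀ s ≤ a, m s = 0
  right : ∀ s, b ≤ s → m s = 0

variable {m : ℝ → ℝ} {a b : ℝ}

lemma IsCutoff.contDiff_kernel (h : IsCutoff m a b) (n : ℕ) :
    ContDiff ℝ 1 fun x => m x * ((1 - x) ^ (n - 1) / x ^ n) :=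
  contDiff_mul_of_vanish_left h.pos h.contDiff h.left fun _ hs =>
    ((contDiffAt_const.sub contDiffAt_id).pow _).div (contDiffAt_id.pow _) (pow_ne_zero _ hs)

lemma IsCutoff.hasDerivAt_cutGreen (h : IsCutoff m a b) (s : ℝ) :
    HasDerivAt (cutGreen n m)
      (-((n + 1) / (4 * n) * (m s * ((1 - s) ^ (n - 1) / s ^ n)))) s := by
  have hc := (h.contDiff_kernel n).continuous
  have := intervalIntegral.integral_hasDerivAt_left (hc.intervalIntegrable s 1)
    hc.stronglyMeasurable.stronglyMeasurableAtFilter hc.continuousAt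
  have h2 := this.const_mul ((n + 1) / (4 * n) : ℝ)
  rw [mul_neg] at h2
  exact h2

lemma IsCutoff.cutGreen_eq_zero (h : IsCutoff m a b) {s : ℝ} (hs : b ≤ s) :
    cutGreen n m s = 0 := by
  unfold cutGreen
  rw [intervalIntegral.integral_congr (g := fun _ => 0), intervalIntegral.integral_zero, mul_zero]
  intro x hx
  have : b ≤ x := by
    have h1 := hx.1
    have : b ≤ min s 1 := le_min hs h.lt_one.le
    linarith
  simp [h.right x this]

lemma IsCutoff.contDiff_cutGreen (h : IsCutoff m a b) : ContDiff ℝ 1 (cutGreen n m) := by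
  rw [contDiff_one_iff_deriv]
  refine ⟨fun s => (h.hasDerivAt_cutGreen s).differentiableAt, ?_⟩
  have : deriv (cutGreen n m) = fun s => -((n + 1) / (4 * n) * (m s * ((1 - s) ^ (n - 1) / s ^ n))) :=
    funext fun s => (h.hasDerivAt_cutGreen s).deriv
  rw [this]
  exact (continuous_const.mul (h.contDiff_kernel n).continuous).neg

/-- The density of the truncated Green function times the invariant measure. -/
def cutDensity (n : ℕ) (m : ℝ → ℝ) (s : ℝ) : ℝ := cutGreen n m s / ((n + 1) * (1 - s) ^ n)

lemma IsCutoff.cutDensity_eventually (h : IsCutoff m a b) {s : ℝ} (hs : b < s) :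
    cutDensity n m =ᶠ[nhds s] fun _ => 0 := by
  filter_upwards [(isOpen_lt continuous_const continuous_id).mem_nhds hs] with y hy
  rw [cutDensity, h.cutGreen_eq_zero (s := y) (le_of_lt hy), zero_div]

lemma IsCutoff.contDiff_cutDensity (h : IsCutoff m a b) : ContDiff ℝ 1 (cutDensity n m) := by
  rw [contDiff_iff_contDiffAt]
  intro s
  by_cases hs : b < s
  · exact contDiffAt_const.congr_of_eventuallyEq (h.cutDensity_eventually hs)
  · refine h.contDiff_cutGreen.contDiffAt.div
      (contDiffAt_const.mul ((contDiffAt_const.sub contDiffAt_id).pow _)) ?_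
    have := h.lt_one
    have h1 : (1 - s) ≠ 0 := by linarith
    have h2 : (n + 1 : ℝ) ≠ 0 := by positivity
    simpa using ⟨h2, fun h => absurd h h1⟩

/-- The radial coefficient `(1 - s) w' - n w` of the density `w`. -/
def cutFlux (n : ℕ) (m : ℝ → ℝ) (s : ℝ) : ℝ := m s * (-(1 / (4 * n)) / s ^ n)

lemma IsCutoff.contDiff_cutFlux (h : IsCutoff m a b) : ContDiff ℝ 1 (cutFlux n m) :=
  contDiff_mul_of_vanish_left h.pos h.contDiff h.left fun _ hs =>
    contDiffAt_const.div (contDiffAt_id.pow _) (pow_ne_zero _ hs)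

/-- The factor `(1 - s)^{-n}` in the density is a solution of `(1 - s) w' = n w`, so only the
derivative of `cutGreen` survives, and its factor `(1 - s)^{n-1}` cancels. -/
lemma IsCutoff.cutDensity_deriv (h : IsCutoff m a b) (hn : 1 ≤ n) (s : ℝ) :
    (1 - s) * deriv (cutDensity n m) s - n * cutDensity n m s = cutFlux n m s := by
  by_cases hs : b < s
  · rw [(h.cutDensity_eventually hs).deriv_eq, (h.cutDensity_eventually hs).eq_of_nhds, cutFlux,
      h.right s hs.le]
    simp
  · have h1 : (1 - s) ≠ 0 := by have := h.lt_one; linarith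
    have h2 : (n + 1 : ℝ) ≠ 0 := by positivity
    have h3 : (n : ℝ) ≠ 0 := by positivity
    have hd := ((hasDerivAt_id s).const_sub 1).fun_pow n
    have hd2 := (h.hasDerivAt_cutGreen (n := n) s).fun_div (hd.const_mul (n + 1 : ℝ))
      (by simpa using ⟨h2, fun h => absurd h h1⟩)
    have hd3 : HasDerivAt (cutDensity n m) _ s := hd2
    rw [hd3.deriv, cutDensity, cutFlux]
    obtain ⟨k, rfl⟩ : ∃ k, n = k + 1 := ⟨n - 1, by omega⟩
    simp only [Nat.add_sub_cancel, id]
    -- Division by `s ^ n` is degenerate at `0`; there the cutoff vanishes and both sides are zero.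
    by_cases hs0 : s = 0
    · subst hs0
      rw [h.left 0 h.pos.le]
      push_cast
      field_simp
      ring
    · push_cast at *
      field_simp
      ring

/-- For `s ≠ 0` the left side is `s^{1-n} (s^n Q)'` with `Q` the flux, and `s^n Q` is a constant
multiple of the cutoff. Thus where `m` is locally constant nothing remains: this is the harmonicity
of `G` off its pole. -/
lemma IsCutoff.cutFlux_deriv (h : IsCutoff m a b) (hn : 1 ≤ n) (s : ℝ) :
    n * cutFlux n m s + s * deriv (cutFlux n m) s = -(1 / (4 * n)) * (deriv m s / s ^ (n - 1)) := by
  obtain ⟨k, rfl⟩ : ∃ k, n = k + 1 := ⟨n - 1, by omega⟩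
  by_cases hs : s < a
  · have h0 : m =ᶠ[nhds s] fun _ => 0 := by
      filter_upwards [(isOpen_lt continuous_id continuous_const).mem_nhds hs] with y hy
      exact h.left y (le_of_lt hy)
    have h1 : cutFlux (k + 1) m =ᶠ[nhds s] fun _ => 0 := by
      filter_upwards [h0] with y hy
      simp [cutFlux, hy]
    rw [h1.deriv_eq, h0.deriv_eq, h1.eq_of_nhds]
    simp
  · have hs0 : s ≠ 0 := by have := h.pos; intro h; linarith
    have hm := (h.contDiff.differentiable_one s).hasDerivAt
    have hd : HasDerivAt (cutFlux (k + 1) m) _ s :=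
      hm.fun_mul ((hasDerivAt_const s (-(1 / (4 * ((k + 1 : ℕ) : ℝ))))).fun_div
        ((hasDerivAt_id s).fun_pow (k + 1)) (pow_ne_zero _ hs0))
    rw [hd.deriv, cutFlux]
    simp only [Nat.add_sub_cancel, id]
    push_cast
    field_simp
    ring

/-- Green's formula for the truncated Green function. -/
theorem integral_invLaplacian_mul_cutGreen (hn : 1 ≤ n) (h : IsCutoff m a b) {u : Cn n → ℝ}
    (hu : ∀ z ∈ unitBall n, ContDiffAt ℝ 2 u z) :
    IntegrableOn (fun z => invLaplacian u z * (cutGreen n m (‖z‖ ^ 2) / (1 - ‖z‖ ^ 2) ^ (n + 1)))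
      (unitBall n) ∧
    ∫ z in unitBall n, invLaplacian u z * (cutGreen n m (‖z‖ ^ 2) / (1 - ‖z‖ ^ 2) ^ (n + 1))
      = -(1 / n) * ∫ z, u z * (deriv m (‖z‖ ^ 2) / (‖z‖ ^ 2) ^ (n - 1)) := by
  have hsq : Real.sqrt b ^ 2 = b := Real.sq_sqrt h.nonneg
  obtain ⟨hI, key⟩ := integral_radial_mul_eq (u := fun z => (u z : ℂ)) (Real.sqrt_nonneg b)
    (by rw [Real.sqrt_lt' one_pos]; linarith [h.lt_one])
    (fun z hz => contDiffAt_ofReal (hu z hz)) (h.contDiff_cutDensity (n := n))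
    (h.contDiff_cutFlux (n := n))
    (fun s hs => by
      rw [hsq] at hs
      simp [cutDensity, h.cutGreen_eq_zero hs])
    (fun s hs => by
      rw [hsq] at hs
      simp [cutFlux, h.right s hs])
    (h.cutDensity_deriv hn)
  have e1 : ∀ z : Cn n, z ∈ unitBall n →
      ((invLaplacian u z * (cutGreen n m (‖z‖ ^ 2) / (1 - ‖z‖ ^ 2) ^ (n + 1)) : ℝ))
      = (4 * ((cutDensity n m (‖z‖ ^ 2) : ℂ) *
        ∑ i, ∑ j, ((if i = j then 1 else 0) - starRingEnd ℂ (z i) * z j)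
          * dzbar i (dz j fun z => (u z : ℂ)) z)).re := by
    intro z hz
    have hz1 : ‖z‖ < 1 := by simpa using hz
    have hz2 : 1 - ‖z‖ ^ 2 ≠ 0 := by nlinarith [norm_nonneg z]
    rw [invLaplacian, invLaplacianC_eq, Complex.re_ofReal_mul, ← mul_assoc,
      show (4 : ℂ) * (cutDensity n m (‖z‖ ^ 2) : ℂ)
        = ((4 * cutDensity n m (‖z‖ ^ 2) : ℝ) : ℂ) by push_cast; ring, Complex.re_ofReal_mul,
      contractInv, cutDensity]
    have h2 : (n + 1 : ℝ) ≠ 0 := by positivity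
    field_simp
    ring
  have e2 : ∀ z : Cn n, z ∉ unitBall n → (4 * ((cutDensity n m (‖z‖ ^ 2) : ℂ) *
        ∑ i, ∑ j, ((if i = j then 1 else 0) - starRingEnd ℂ (z i) * z j)
          * dzbar i (dz j fun z => (u z : ℂ)) z)).re = 0 := by
    intro z hz
    have hz1 : 1 ≤ ‖z‖ := by simpa using hz
    have : b ≤ ‖z‖ ^ 2 := by nlinarith [h.lt_one]
    simp [cutDensity, h.cutGreen_eq_zero this]
  have hI4 := hI.const_mul 4
  constructor
  · refine IntegrableOn.congr_fun (hI4.re.integrableOn (s := unitBall n)) ?_ measurableSet_ball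
    intro z hz
    exact (e1 z hz).symm
  · rw [setIntegral_congr_fun measurableSet_ball e1,
      setIntegral_eq_integral_of_forall_compl_eq_zero e2]
    have := integral_re hI4
    simp only [RCLike.re_to_complex] at this
    rw [this, integral_const_mul, key]
    simp only [h.cutFlux_deriv hn]
    rw [← integral_const_mul]
    have e3 : ∀ z : Cn n, (4 : ℂ) * ((u z : ℂ) * ((-(1 / (4 * n)) * (deriv m (‖z‖ ^ 2)
        / (‖z‖ ^ 2) ^ (n - 1)) : ℝ) : ℂ)) = ((-(1 / n) * (u z * (deriv m (‖z‖ ^ 2)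
        / (‖z‖ ^ 2) ^ (n - 1))) : ℝ) : ℂ) := by
      intro z
      push_cast
      field_simp
    simp only [e3]
    rw [integral_complex_ofReal, Complex.ofReal_re, integral_const_mul]

end Weights

/-! ### Polar coordinates and the normalization of the sphere -/

section Polar

lemma finrank_Cn (n : ℕ) : Module.finrank ℝ (Cn n) = 2 * n := by
  rw [← Module.finrank_mul_finrank ℝ ℂ (Cn n), Complex.finrank_real_complex,
    finrank_euclideanSpace_fin]

lemma nontrivial_Cn (hn : 1 ≤ n) : Nontrivial (Cn n) :=
  Module.nontrivial_of_finrank_pos (R := ℝ) (by rw [finrank_Cn]; omega)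

/-- The surface measure of the unit sphere. -/
abbrev surface (n : ℕ) : Measure (unitSphere n) := (volume : Measure (Cn n)).toSphere

/-- The map `z ↦ (z/|z|, |z|)` is measure preserving off the origin, which is a null set. The
exponent is the real dimension `2n` minus one. -/
lemma polar_prod {𝕜 : Type*} [RCLike 𝕜] (hn : 1 ≤ n) (F : Cn n → 𝕜) :
    (Integrable F ↔ Integrable (fun p : unitSphere n × Set.Ioi (0 : ℝ) => F (p.2.1 • p.1.1))
      ((surface n).prod (.volumeIoiPow (2 * n - 1)))) ∧
    ∫ z, F z = ∫ p : unitSphere n × Set.Ioi (0 : ℝ), F (p.2.1 • p.1.1)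
      ∂((surface n).prod (.volumeIoiPow (2 * n - 1))) := by
  have := nontrivial_Cn hn
  have hmp := (volume : Measure (Cn n)).measurePreserving_homeomorphUnitSphereProd
  rw [finrank_Cn] at hmp
  have hcomp : (fun p : unitSphere n × Set.Ioi (0 : ℝ) => F (p.2.1 • p.1.1)) ∘
      homeomorphUnitSphereProd (Cn n) = fun x => F x.1 := by
    ext x
    have hx : ‖x.1‖ ≠ 0 := norm_ne_zero_iff.mpr x.2
    simp [smul_smul, hx]
  constructor
  · rw [← hmp.integrable_comp_emb (Homeomorph.measurableEmbedding _), hcomp]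
    rw [← restrict_compl_singleton (μ := (volume : Measure (Cn n))) 0, ← IntegrableOn,
      integrableOn_iff_comap_subtypeVal (by measurability)]
    simp only [restrict_compl_singleton]
    rfl
  · rw [← hmp.integral_comp (Homeomorph.measurableEmbedding _)]
    have h2 : ∀ x, F ((homeomorphUnitSphereProd (Cn n) x).2.1
        • (homeomorphUnitSphereProd (Cn n) x).1.1) = F x.1 := fun x => congrFun hcomp x
    simp only [h2]
    rw [integral_subtype_comap (measurableSet_singleton _).compl F, restrict_compl_singleton]

lemma integral_volumeIoiPow {𝕜 : Type*} [RCLike 𝕜] (k : ℕ) (R : ℝ → 𝕜) :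
    (IntegrableOn (fun t : ℝ => (t : 𝕜) ^ k * R t) (Set.Ioi 0) ↔
      Integrable (fun t : Set.Ioi (0 : ℝ) => R t) (.volumeIoiPow k)) ∧
    ∫ t : Set.Ioi (0 : ℝ), R t ∂(.volumeIoiPow k) = ∫ t in Set.Ioi (0 : ℝ), (t : 𝕜) ^ k * R t := by
  constructor
  · rw [integrableOn_iff_comap_subtypeVal measurableSet_Ioi, Measure.volumeIoiPow,
      integrable_withDensity_iff_integrable_smul' (by fun_prop) (by simp)]
    refine integrable_congr (Filter.Eventually.of_forall fun x => ?_)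
    have hx : 0 ≤ x.1 ^ k := pow_nonneg x.2.out.le _
    simp [ENNReal.toReal_ofReal hx, RCLike.real_smul_eq_coe_mul]
  · simp only [Measure.volumeIoiPow, ENNReal.ofReal]
    rw [integral_withDensity_eq_integral_smul,
      integral_subtype_comap measurableSet_Ioi fun a ↦ Real.toNNReal (a ^ k) • R a,
      setIntegral_congr_fun measurableSet_Ioi fun x hx ↦ ?_]
    · rw [NNReal.smul_def, Real.coe_toNNReal _ (pow_nonneg hx.out.le _),
        RCLike.real_smul_eq_coe_mul]
      push_cast
      rfl
    · exact (measurable_subtype_coe.pow_const _).real_toNNReal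

/-- Integration in polar coordinates of a product of a function of the direction and a function
of the norm. -/
lemma integral_polar_mul {𝕜 : Type*} [RCLike 𝕜] (hn : 1 ≤ n) {F : Cn n → 𝕜}
    (g : unitSphere n → 𝕜) (R : ℝ → 𝕜)
    (hF : ∀ (ξ : unitSphere n) (t : ℝ), 0 < t → F (t • (ξ : Cn n)) = g ξ * R t) :
    ∫ z, F z = (∫ ξ, g ξ ∂(surface n))
      * ∫ t in Set.Ioi (0 : ℝ), (t : 𝕜) ^ (2 * n - 1) * R t := by
  rw [(polar_prod hn F).2, ← (integral_volumeIoiPow _ R).2, ← integral_prod_mul]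
  exact integral_congr_ae (Filter.Eventually.of_forall fun p => hF p.1 p.2.1 p.2.2)

lemma integrable_polar_mul {𝕜 : Type*} [RCLike 𝕜] (hn : 1 ≤ n) {F : Cn n → 𝕜}
    {g : unitSphere n → 𝕜} {R : ℝ → 𝕜}
    (hF : ∀ (ξ : unitSphere n) (t : ℝ), 0 < t → F (t • (ξ : Cn n)) = g ξ * R t)
    (hg : Integrable g (surface n))
    (hR : IntegrableOn (fun t : ℝ => (t : 𝕜) ^ (2 * n - 1) * R t) (Set.Ioi 0)) :
    Integrable F := by
  rw [(polar_prod hn F).1]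
  refine (hg.mul_prod ((integral_volumeIoiPow _ R).1.1 hR)).congr ?_
  exact Filter.Eventually.of_forall fun p => (hF p.1 p.2.1 p.2.2).symm

lemma surface_univ (hn : 1 ≤ n) :
    surface n Set.univ = ENNReal.ofReal (2 * n * (Real.pi ^ n / n.factorial)) := by
  have := nontrivial_Cn hn
  rw [surface, Measure.toSphere_apply_univ,
    InnerProductSpace.volume_ball_of_dim_even (finrank_Cn n), finrank_Cn]
  rw [ENNReal.ofReal_one, one_pow, one_mul, ENNReal.ofReal_mul (by positivity)]
  congr 1
  rw [ENNReal.ofReal_mul (by positivity)]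
  simp

lemma integral_sphereMeasure {E : Type*} [NormedAddCommGroup E] [NormedSpace ℝ E] (hn : 1 ≤ n)
    (g : unitSphere n → E) :
    ∫ ξ, g ξ ∂(sphereMeasure n)
      = ((n.factorial : ℝ) / Real.pi ^ n / (2 * n)) • ∫ ξ, g ξ ∂(surface n) := by
  rw [sphereMeasure, integral_smul_measure, surface_univ hn, ENNReal.toReal_inv,
    ENNReal.toReal_ofReal (by positivity)]
  congr 1
  field_simp

lemma isProbabilityMeasure_sphereMeasure (hn : 1 ≤ n) :
    IsProbabilityMeasure (sphereMeasure n) := by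
  constructor
  rw [sphereMeasure, Measure.smul_apply, smul_eq_mul, ENNReal.inv_mul_cancel]
  · rw [surface_univ hn]
    simp only [ne_eq, ENNReal.ofReal_eq_zero, not_le]
    positivity
  · exact measure_ne_top _ _

end Polar

/-! ### Explicit cutoffs and convergence to Green's function -/

section Cutoff

/-- The cutoff near the origin. -/
def lowCut (K : ℕ) (s : ℝ) : ℝ := Real.smoothTransition (K * s - 1)

/-- The cutoff near the boundary. -/
def highCut (K : ℕ) (s : ℝ) : ℝ := Real.smoothTransition (K * (1 - s) - 1)

/-- The product of the two cutoffs. -/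
def cut (K : ℕ) (s : ℝ) : ℝ := lowCut K s * highCut K s

lemma contDiff_lowCut (K : ℕ) : ContDiff ℝ 1 (lowCut K) :=
  (Real.smoothTransition.contDiff (n := 1)).comp
    ((contDiff_const.mul contDiff_id).sub contDiff_const)

lemma contDiff_highCut (K : ℕ) : ContDiff ℝ 1 (highCut K) :=
  (Real.smoothTransition.contDiff (n := 1)).comp
    ((contDiff_const.mul (contDiff_const.sub contDiff_id)).sub contDiff_const)

lemma isCutoff_cut {K : ℕ} (hK : 2 ≤ K) : IsCutoff (cut K) (1 / K) (1 - 1 / K) := by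
  have hK' : (2 : ℝ) ≤ K := by exact_mod_cast hK
  have h0 : (0 : ℝ) < K := by linarith
  refine ⟨(contDiff_lowCut K).mul (contDiff_highCut K), by positivity, ?_, ?_, ?_, ?_⟩
  · have : (0 : ℝ) < 1 / K := by positivity
    linarith
  · have : (1 : ℝ) / K ≤ 1 := by rw [div_le_one h0]; linarith
    linarith
  · intro s hs
    rw [le_div_iff₀ h0] at hs
    rw [cut, lowCut, Real.smoothTransition.zero_of_nonpos (by linarith), zero_mul]
  · intro s hs
    have hs : 1 - s ≤ 1 / K := by linarith
    rw [le_div_iff₀ h0] at hs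
    rw [cut, highCut, Real.smoothTransition.zero_of_nonpos (by linarith), mul_zero]

lemma cut_nonneg (K : ℕ) (s : ℝ) : 0 ≤ cut K s :=
  mul_nonneg (Real.smoothTransition.nonneg _) (Real.smoothTransition.nonneg _)

lemma cut_le_one (K : ℕ) (s : ℝ) : cut K s ≤ 1 :=
  mul_le_one₀ (Real.smoothTransition.le_one _) (Real.smoothTransition.nonneg _)
    (Real.smoothTransition.le_one _)

lemma monotone_lowCut (K : ℕ) : Monotone (lowCut K) := fun x y h => by
  refine Real.smoothTransition.monotone ?_
  have : (0 : ℝ) ≤ K := by positivity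
  nlinarith

lemma antitone_highCut (K : ℕ) : Antitone (highCut K) := fun x y h => by
  refine Real.smoothTransition.monotone ?_
  have : (0 : ℝ) ≤ K := by positivity
  nlinarith

lemma deriv_highCut_nonpos (K : ℕ) (s : ℝ) : deriv (highCut K) s ≤ 0 :=
  (antitone_highCut K).deriv_nonpos

/-- The increasing inner cutoff contributes to `-deriv (cut K)` with a negative sign. Discarding it
amounts to discarding the term `-u(0)` of Green's formula, which is harmless for `u ≥ 0`. -/
lemma neg_deriv_cut_le (K : ℕ) (s : ℝ) : -deriv (cut K) s ≤ -deriv (highCut K) s := by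
  have h1 := ((contDiff_lowCut K).differentiable_one s).hasDerivAt
  have h2 := ((contDiff_highCut K).differentiable_one s).hasDerivAt
  have h3 : HasDerivAt (cut K) _ s := h1.mul h2
  rw [h3.deriv]
  have a1 : 0 ≤ deriv (lowCut K) s := (monotone_lowCut K).deriv_nonneg
  have a2 := deriv_highCut_nonpos K s
  have a3 : 0 ≤ highCut K s := Real.smoothTransition.nonneg _
  have a4 : lowCut K s ≤ 1 := Real.smoothTransition.le_one _
  nlinarith [mul_nonneg a1 a3]

lemma tendsto_cut {s : ℝ} (h0 : 0 < s) (h1 : s < 1) :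
    Filter.Tendsto (fun K => cut K s) Filter.atTop (nhds 1) := by
  have e1 : ∀ t : ℝ, 0 < t → ∀ᶠ K : ℕ in Filter.atTop, 1 ≤ K * t - 1 := by
    intro t ht
    have h := (tendsto_natCast_atTop_atTop (R := ℝ)).atTop_mul_const ht
    filter_upwards [h.eventually_ge_atTop 2] with K hK
    linarith
  refine tendsto_const_nhds.congr' ?_
  filter_upwards [e1 s h0, e1 (1 - s) (by linarith)] with K hK hK'
  rw [cut, lowCut, highCut, Real.smoothTransition.one_of_one_le hK,
    Real.smoothTransition.one_of_one_le hK', mul_one]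

lemma deriv_highCut_eq_zero {K : ℕ} {s : ℝ} (hs : K * (1 - s) > 2) : deriv (highCut K) s = 0 := by
  have : highCut K =ᶠ[nhds s] fun _ => 1 := by
    have hc : Continuous fun s : ℝ => K * (1 - s) := by fun_prop
    filter_upwards [(isOpen_lt continuous_const hc).mem_nhds hs] with y hy
    have hy' : 2 < K * (1 - y) := hy
    exact Real.smoothTransition.one_of_one_le (by linarith)
  rw [this.deriv_eq]
  simp

/-- The outer cutoff drops from one to zero, so `-highCut K (t ^ 2) / 2` is an antiderivative with
total increase `1/2`, whatever `K` is. The assumption `2 ≤ K` ensures that the cutoff equals one at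
the origin. -/
lemma integral_mul_deriv_highCut {K : ℕ} (hK : 2 ≤ K) :
    IntegrableOn (fun t : ℝ => t * -deriv (highCut K) (t ^ 2)) (Set.Ioi 0) ∧
    ∫ t in Set.Ioi (0 : ℝ), t * -deriv (highCut K) (t ^ 2) = 1 / 2 := by
  have hK' : (2 : ℝ) ≤ K := by exact_mod_cast hK
  have hd : ∀ t ∈ Set.Ici (0 : ℝ), HasDerivAt (fun t => -(1 / 2) * highCut K (t ^ 2))
      (t * -deriv (highCut K) (t ^ 2)) t := by
    intro t _
    have h2 := ((contDiff_highCut K).differentiable_one (t ^ 2)).hasDerivAt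
    have h3 := (HasDerivAt.comp (h := fun t : ℝ => t ^ 2) (h₂ := highCut K) t h2
      (hasDerivAt_pow 2 t)).const_mul (-(1 / 2) : ℝ)
    convert! h3 using 1
    simp
    ring
  have hpos : ∀ t ∈ Set.Ioi (0 : ℝ), 0 ≤ t * -deriv (highCut K) (t ^ 2) := fun t ht =>
    mul_nonneg (le_of_lt ht) (by linarith [deriv_highCut_nonpos K (t ^ 2)])
  have hlim : Filter.Tendsto (fun t => -(1 / 2) * highCut K (t ^ 2)) Filter.atTop (nhds 0) := by
    refine tendsto_const_nhds.congr' ?_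
    filter_upwards [Filter.eventually_ge_atTop 1] with t ht
    rw [highCut, Real.smoothTransition.zero_of_nonpos, mul_zero]
    have : 1 ≤ t ^ 2 := by nlinarith
    nlinarith
  refine ⟨integrableOn_Ioi_deriv_of_nonneg' hd hpos hlim, ?_⟩
  rw [integral_Ioi_of_hasDerivAt_of_nonneg' hd hpos hlim]
  rw [highCut, Real.smoothTransition.one_of_one_le (by linarith)]
  norm_num

/-- The substitution `x = t²`, whose Jacobian turns the constant `(n + 1)/(2n)` into `(n + 1)/(4n)`.
-/
lemma green_eq {z : Cn n} (hn : 1 ≤ n) (hz0 : z ≠ 0) (hz1 : ‖z‖ < 1) :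
    green z = (n + 1) / (4 * n) * ∫ x in (‖z‖ ^ 2)..1, (1 - x) ^ (n - 1) / x ^ n := by
  have hpos : 0 < ‖z‖ := norm_pos_iff.mpr hz0
  have hI : Set.uIcc ‖z‖ 1 = Set.Icc ‖z‖ 1 := Set.uIcc_of_le hz1.le
  have h := intervalIntegral.integral_comp_mul_deriv'' (a := ‖z‖) (b := 1) (f := fun t => t ^ 2)
    (f' := fun t => 2 * t) (g := fun x => (1 - x) ^ (n - 1) / x ^ n) (by fun_prop)
    (fun x _ => by
      have := (hasDerivAt_pow 2 x).hasDerivWithinAt (s := Set.Ioi x)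
      simpa using this) (by fun_prop) (by
      intro x hx
      obtain ⟨t, ht, rfl⟩ := hx
      rw [hI] at ht
      have : 0 < t := lt_of_lt_of_le hpos ht.1
      exact (ContinuousAt.div (by fun_prop) (by fun_prop) (by positivity)).continuousWithinAt)
  rw [one_pow] at h
  rw [← h, green]
  have h2 : ∫ t in ‖z‖..1, ((fun x => (1 - x) ^ (n - 1) / x ^ n) ∘ fun t => t ^ 2) t * (2 * t)
      = ∫ t in ‖z‖..1, 2 * ((1 - t ^ 2) ^ (n - 1) / t ^ (2 * n - 1)) := by
    refine intervalIntegral.integral_congr fun t ht => ?_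
    rw [hI] at ht
    have : 0 < t := lt_of_lt_of_le hpos ht.1
    obtain ⟨k, rfl⟩ : ∃ k, n = k + 1 := ⟨n - 1, by omega⟩
    rw [show 2 * (k + 1) - 1 = 2 * k + 1 by omega]
    simp only [Function.comp, Nat.add_sub_cancel]
    field_simp
    ring
  rw [h2, intervalIntegral.integral_const_mul]
  ring

lemma tendsto_cutGreen {z : Cn n} (hn : 1 ≤ n) (hz0 : z ≠ 0) (hz1 : ‖z‖ < 1) :
    Filter.Tendsto (fun K => cutGreen n (cut K) (‖z‖ ^ 2)) Filter.atTop (nhds (green z)) := by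
  have hpos : 0 < ‖z‖ := norm_pos_iff.mpr hz0
  have hlt : ‖z‖ ^ 2 < 1 := by nlinarith
  rw [green_eq hn hz0 hz1]
  unfold cutGreen
  refine Filter.Tendsto.const_mul _ ?_
  have hc : ContinuousOn (fun x : ℝ => (1 - x) ^ (n - 1) / x ^ n) (Set.uIcc (‖z‖ ^ 2) 1) := by
    intro x hx
    rw [Set.uIcc_of_le hlt.le] at hx
    have : 0 < x := lt_of_lt_of_le (by positivity) hx.1
    exact (ContinuousAt.div (by fun_prop) (by fun_prop) (by positivity)).continuousWithinAt
  refine intervalIntegral.tendsto_integral_filter_of_dominated_convergence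
    (fun x => ‖(1 - x) ^ (n - 1) / x ^ n‖) ?_ ?_ hc.norm.intervalIntegrable ?_
  · refine Filter.Eventually.of_forall fun K => ?_
    refine (Measurable.aestronglyMeasurable ?_)
    have : Measurable (cut K) :=
      ((contDiff_lowCut K).mul (contDiff_highCut K)).continuous.measurable
    fun_prop
  · refine Filter.Eventually.of_forall fun K => Filter.Eventually.of_forall fun x _ => ?_
    rw [norm_mul, Real.norm_of_nonneg (cut_nonneg K x)]
    exact mul_le_of_le_one_left (norm_nonneg _) (cut_le_one K x)
  · have h1 : ∀ᵐ x : ℝ, x ≠ 1 := by simp [ae_iff]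
    filter_upwards [h1] with x hx1 hx
    rw [Set.uIoc_of_le hlt.le] at hx
    have := (tendsto_cut (lt_trans (by positivity) hx.1) (lt_of_le_of_ne hx.2 hx1)).mul_const
      ((1 - x) ^ (n - 1) / x ^ n)
    simpa using this

lemma cutGreen_nonneg (K : ℕ) {z : Cn n} (hz1 : ‖z‖ < 1) :
    0 ≤ cutGreen n (cut K) (‖z‖ ^ 2) := by
  have hlt : ‖z‖ ^ 2 ≤ 1 := by nlinarith [norm_nonneg z]
  refine mul_nonneg (by positivity) (intervalIntegral.integral_nonneg hlt fun x hx => ?_)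
  have h0 : 0 ≤ x := le_trans (by positivity) hx.1
  have h1 : 0 ≤ 1 - x := by linarith [hx.2]
  exact mul_nonneg (cut_nonneg K x) (by positivity)

lemma green_nonneg {z : Cn n} (hz1 : ‖z‖ < 1) : 0 ≤ green z := by
  refine mul_nonneg (by positivity) (intervalIntegral.integral_nonneg hz1.le fun x hx => ?_)
  have h0 : 0 ≤ x := le_trans (norm_nonneg _) hx.1
  have h1 : 0 ≤ 1 - x ^ 2 := by nlinarith [hx.2]
  positivity

end Cutoff

/-! ### The bound of a Green potential by a boundary mean -/

section Estimate

/-- A continuous function on `ℂⁿ` is, near the sphere, almost bounded by its boundary values. -/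
lemma exists_le_boundary_add {q : Cn n → ℝ} (hq : Continuous q) {ε : ℝ} (hε : 0 < ε) :
    ∃ δ > 0, ∀ z : Cn n, ‖z‖ < 1 → 1 - δ < ‖z‖ → q z ≤ q ((‖z‖⁻¹ : ℝ) • z) + ε := by
  have hu := (isCompact_closedBall (0 : Cn n) 1).uniformContinuousOn_of_continuous hq.continuousOn
  rw [Metric.uniformContinuousOn_iff] at hu
  obtain ⟨δ, hδ, h⟩ := hu ε hε
  refine ⟨min δ 1, by positivity, fun z hz1 hz2 => ?_⟩
  have hz0 : 0 < ‖z‖ := by linarith [min_le_right δ 1]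
  have hn1 : ‖(‖z‖⁻¹ : ℝ) • z‖ = 1 := by
    rw [norm_smul, norm_inv, norm_norm, inv_mul_cancel₀ hz0.ne']
  have hd : dist z ((‖z‖⁻¹ : ℝ) • z) < δ := by
    have : z - (‖z‖⁻¹ : ℝ) • z = (1 - ‖z‖⁻¹ : ℝ) • z := by rw [sub_smul, one_smul]
    rw [dist_eq_norm, this, norm_smul, Real.norm_eq_abs]
    have h2 : |1 - ‖z‖⁻¹| * ‖z‖ = |(1 - ‖z‖⁻¹) * ‖z‖| := by rw [abs_mul, abs_norm]
    rw [h2, sub_mul, inv_mul_cancel₀ hz0.ne', one_mul, abs_sub_comm, abs_of_pos (by linarith)]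
    linarith [min_le_left δ 1]
  have := h z (by simpa using hz1.le) _ (by simp [hn1]) hd
  rw [Real.dist_eq] at this
  linarith [(abs_lt.1 this).2]

/-- The outer cutoff varies only in a thin shell at the sphere, where `u ≤ q` and `q` is within `ε`
of its radial boundary value. Boundary values are needed only for the majorant `q`, never for `u`.
-/
lemma eventually_cut_bound (hn : 1 ≤ n) {u q : Cn n → ℝ} (hq : Continuous q)
    (hu0 : ∀ z ∈ unitBall n, 0 ≤ u z) (huq : ∀ z ∈ unitBall n, u z ≤ q z) {ε : ℝ} (hε : 0 < ε) :
    ∀ᶠ K in Filter.atTop, -(1 / n) * ∫ z, u z * (deriv (cut K) (‖z‖ ^ 2) / (‖z‖ ^ 2) ^ (n - 1))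
      ≤ 1 / (2 * n) * ∫ ξ : unitSphere n, (|q ξ| + ε) ∂(surface n) := by
  obtain ⟨δ, hδ, hδq⟩ := exists_le_boundary_add hq hε
  have hlim : ∀ᶠ K : ℕ in Filter.atTop, 2 < K * δ :=
    ((tendsto_natCast_atTop_atTop (R := ℝ)).atTop_mul_const hδ).eventually_gt_atTop 2
  filter_upwards [Filter.eventually_ge_atTop 2, hlim] with K hK hKδ
  have hcut := isCutoff_cut hK
  have hK' : (2 : ℝ) ≤ K := by exact_mod_cast hK
  -- A majorant that is a function of the direction times a function of the norm, hence integrable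
  -- exactly in polar coordinates. The absolute value keeps it nonnegative everywhere.
  set G : Cn n → ℝ := fun z => (|q ((‖z‖⁻¹ : ℝ) • z)| + ε)
    * (-deriv (highCut K) (‖z‖ ^ 2) / (‖z‖ ^ 2) ^ (n - 1)) with hG
  have hGR : ∀ (ξ : unitSphere n) (t : ℝ), 0 < t → G (t • (ξ : Cn n))
      = (|q ξ| + ε) * (-deriv (highCut K) (t ^ 2) / (t ^ 2) ^ (n - 1)) := by
    intro ξ t ht
    have hξ : ‖(ξ : Cn n)‖ = 1 := by simp
    have h1 : ‖t • (ξ : Cn n)‖ = t := by rw [norm_smul, hξ, mul_one, Real.norm_of_nonneg ht.le]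
    simp only [hG, h1, smul_smul, inv_mul_cancel₀ ht.ne', one_smul]
  have hR : ∀ t ∈ Set.Ioi (0 : ℝ), ((t : ℝ) : ℝ) ^ (2 * n - 1)
      * (-deriv (highCut K) (t ^ 2) / (t ^ 2) ^ (n - 1)) = t * -deriv (highCut K) (t ^ 2) := by
    intro t ht
    have : t ≠ 0 := ne_of_gt ht
    obtain ⟨k, rfl⟩ : ∃ k, n = k + 1 := ⟨n - 1, by omega⟩
    rw [show 2 * (k + 1) - 1 = 2 * k + 1 by omega]
    simp only [Nat.add_sub_cancel]
    field_simp
    ring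
  obtain ⟨hi, hv⟩ := integral_mul_deriv_highCut hK
  have hqi : Integrable (fun ξ : unitSphere n => |q ξ| + ε) (surface n) := by
    have : CompactSpace (unitSphere n) := isCompact_iff_compactSpace.mp (isCompact_sphere _ _)
    have hc : Continuous fun ξ : unitSphere n => |q ξ| + ε := by fun_prop
    exact hc.integrable_of_hasCompactSupport (HasCompactSupport.of_compactSpace _)
  have hGi : Integrable G := integrable_polar_mul (𝕜 := ℝ) hn hGR hqi
    (hi.congr_fun (fun t ht => (hR t ht).symm) measurableSet_Ioi)
  have hGv : ∫ z, G z = (∫ ξ : unitSphere n, (|q ξ| + ε) ∂(surface n)) * (1 / 2) := by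
    rw [integral_polar_mul (𝕜 := ℝ) hn _ _ hGR, ← hv]
    congr 1
    exact setIntegral_congr_fun measurableSet_Ioi hR
  have hG0 : ∀ z, 0 ≤ G z := fun z => by
    have := deriv_highCut_nonpos K (‖z‖ ^ 2)
    have h2 : 0 ≤ -deriv (highCut K) (‖z‖ ^ 2) := by linarith
    simp only [hG]
    positivity
  have hle : ∀ z, -(u z * (deriv (cut K) (‖z‖ ^ 2) / (‖z‖ ^ 2) ^ (n - 1))) ≤ G z := by
    intro z
    by_cases hz : ‖z‖ < 1
    · have hzb : z ∈ unitBall n := by simpa using hz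
      have hp : 0 ≤ (‖z‖ ^ 2) ^ (n - 1) := by positivity
      have h1 : -(u z * (deriv (cut K) (‖z‖ ^ 2) / (‖z‖ ^ 2) ^ (n - 1)))
          ≤ u z * (-deriv (highCut K) (‖z‖ ^ 2) / (‖z‖ ^ 2) ^ (n - 1)) := by
        rw [← mul_neg, ← neg_div]
        exact mul_le_mul_of_nonneg_left (div_le_div_of_nonneg_right (neg_deriv_cut_le K _) hp)
          (hu0 z hzb)
      refine h1.trans ?_
      -- Inside the shell the outer cutoff is locally constant; in the shell, `1 - |z|² ≤ 2/K < δ`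
      -- puts `z` close enough to the sphere.
      by_cases hz2 : 2 < K * (1 - ‖z‖ ^ 2)
      · rw [deriv_highCut_eq_zero hz2]
        simpa using hG0 z
      · have h3 : 1 - δ < ‖z‖ := by
          have a : 1 - ‖z‖ ^ 2 < δ := by nlinarith
          nlinarith [norm_nonneg z]
        refine mul_le_mul_of_nonneg_right ?_ (div_nonneg ?_ hp)
        · exact (huq z hzb).trans ((hδq z hz h3).trans (by gcongr; exact le_abs_self _))
        · linarith [deriv_highCut_nonpos K (‖z‖ ^ 2)]
    · have h1 : deriv (cut K) (‖z‖ ^ 2) = 0 := by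
        have : (1 - 1 / K : ℝ) < ‖z‖ ^ 2 := by nlinarith [hcut.lt_one]
        have : cut K =ᶠ[nhds (‖z‖ ^ 2)] fun _ => 0 := by
          filter_upwards [(isOpen_lt continuous_const continuous_id).mem_nhds this] with y hy
          exact hcut.right y (le_of_lt hy)
        rw [this.deriv_eq]; simp
      rw [h1]
      simpa using hG0 z
  have hfin : ∫ z, -(u z * (deriv (cut K) (‖z‖ ^ 2) / (‖z‖ ^ 2) ^ (n - 1))) ≤ ∫ z, G z := by
    -- If integrability fails, the Bochner integral is zero by convention and the bound reduces to
    -- `0 ≤ ∫ G`.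
    by_cases hint : Integrable (fun z => -(u z * (deriv (cut K) (‖z‖ ^ 2) / (‖z‖ ^ 2) ^ (n - 1))))
    · exact integral_mono hint hGi hle
    · rw [integral_undef hint]
      exact integral_nonneg hG0
  rw [integral_neg, hGv] at hfin
  have hn0 : (0 : ℝ) < n := by exact_mod_cast hn
  calc -(1 / (n : ℝ)) * ∫ z, u z * (deriv (cut K) (‖z‖ ^ 2) / (‖z‖ ^ 2) ^ (n - 1))
      = 1 / n * -∫ z, u z * (deriv (cut K) (‖z‖ ^ 2) / (‖z‖ ^ 2) ^ (n - 1)) := by ring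
    _ ≤ 1 / n * ((∫ ξ : unitSphere n, (|q ξ| + ε) ∂(surface n)) * (1 / 2)) := by gcongr
    _ = _ := by ring

/-- If `u ≥ 0` has nonnegative invariant Laplacian and is bounded by the continuous function `q`,
its Green potential is bounded by the mean of `q` over the sphere. -/
theorem lintegral_invLaplacian_mul_green_le (hn : 1 ≤ n) {u q F : Cn n → ℝ} (hq : Continuous q)
    (hq0 : ∀ z, 0 ≤ q z) (hu : ∀ z ∈ unitBall n, ContDiffAt ℝ 2 u z)
    (hu0 : ∀ z ∈ unitBall n, 0 ≤ u z) (huq : ∀ z ∈ unitBall n, u z ≤ q z)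
    (hFm : ContinuousOn F (unitBall n))
    (hF0 : ∀ z ∈ unitBall n, 0 ≤ F z) (hFu : ∀ z ∈ unitBall n, F z ≤ invLaplacian u z) :
    ∫⁻ z in unitBall n, ENNReal.ofReal ((n.factorial : ℝ) / Real.pi ^ n
        * (F z * (green z / (1 - ‖z‖ ^ 2) ^ (n + 1))))
      ≤ ENNReal.ofReal (∫ ξ : unitSphere n, q ξ ∂(sphereMeasure n)) := by
  have := nontrivial_Cn hn
  have hprob := isProbabilityMeasure_sphereMeasure hn
  have hn0 : (0 : ℝ) < n := by exact_mod_cast hn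
  set c : ℝ := (n.factorial : ℝ) / Real.pi ^ n with hc
  have hc0 : 0 < c := by positivity
  have hball : ∀ z ∈ unitBall n, ‖z‖ < 1 := fun z hz => by simpa using hz
  have hw : ∀ z ∈ unitBall n, 0 < (1 - ‖z‖ ^ 2) ^ (n + 1) := fun z hz => by
    have := hball z hz
    have : 0 < 1 - ‖z‖ ^ 2 := by nlinarith [norm_nonneg z]
    positivity
  have hcs : CompactSpace (unitSphere n) := isCompact_iff_compactSpace.mp (isCompact_sphere _ _)
  have hqi : Integrable (fun ξ : unitSphere n => q ξ) (sphereMeasure n) := by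
    have hc : Continuous fun ξ : unitSphere n => q ξ := by fun_prop
    exact hc.integrable_of_hasCompactSupport (HasCompactSupport.of_compactSpace _)
  have hK : ∀ ε > 0, ∀ᶠ K in Filter.atTop, ∫⁻ z in unitBall n, ENNReal.ofReal (c
      * (F z * (cutGreen n (cut K) (‖z‖ ^ 2) / (1 - ‖z‖ ^ 2) ^ (n + 1))))
      ≤ ENNReal.ofReal (∫ ξ : unitSphere n, q ξ ∂(sphereMeasure n) + ε) := by
    intro ε hε
    filter_upwards [eventually_cut_bound hn hq hu0 huq hε, Filter.eventually_ge_atTop 2]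
      with K hKb hK2
    obtain ⟨hI, hv⟩ := integral_invLaplacian_mul_cutGreen hn (isCutoff_cut hK2) hu
    have hnn : 0 ≤ᵐ[volume.restrict (unitBall n)] fun z =>
        c * (invLaplacian u z * (cutGreen n (cut K) (‖z‖ ^ 2) / (1 - ‖z‖ ^ 2) ^ (n + 1))) := by
      filter_upwards [ae_restrict_mem measurableSet_ball] with z hz
      have h1 := cutGreen_nonneg (n := n) K (hball z hz)
      have h2 := (hF0 z hz).trans (hFu z hz)
      exact mul_nonneg hc0.le (mul_nonneg h2 (div_nonneg h1 (hw z hz).le))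
    calc _ ≤ ∫⁻ z in unitBall n, ENNReal.ofReal (c * (invLaplacian u z
          * (cutGreen n (cut K) (‖z‖ ^ 2) / (1 - ‖z‖ ^ 2) ^ (n + 1)))) := by
          refine setLIntegral_mono' measurableSet_ball fun z hz => ?_
          have h1 := cutGreen_nonneg (n := n) K (hball z hz)
          have h2 := hFu z hz
          have h3 := hw z hz
          gcongr
      _ = ENNReal.ofReal (∫ z in unitBall n, c * (invLaplacian u z
          * (cutGreen n (cut K) (‖z‖ ^ 2) / (1 - ‖z‖ ^ 2) ^ (n + 1)))) :=
          (ofReal_integral_eq_lintegral_ofReal (hI.const_mul c) hnn).symm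
      _ ≤ _ := by
          refine ENNReal.ofReal_le_ofReal ?_
          rw [integral_const_mul, hv]
          refine (mul_le_mul_of_nonneg_left hKb hc0.le).trans (le_of_eq ?_)
          have e := integral_sphereMeasure hn (fun ξ : unitSphere n => |q ξ| + ε)
          have e2 : ∫ ξ : unitSphere n, (|q ξ| + ε) ∂(sphereMeasure n)
              = ∫ ξ : unitSphere n, q ξ ∂(sphereMeasure n) + ε := by
            simp only [abs_of_nonneg (hq0 _)]
            rw [integral_add hqi (integrable_const _)]
            simp
          rw [← e2, e, smul_eq_mul]
          ring
  refine ENNReal.le_of_forall_pos_le_add fun ε hε _ => ?_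
  -- Fatou's lemma as `K → ∞`. The pole of `G` is excluded as a null set.
  have hFat : ∫⁻ z in unitBall n, ENNReal.ofReal (c * (F z * (green z / (1 - ‖z‖ ^ 2) ^ (n + 1))))
      ≤ Filter.liminf (fun K => ∫⁻ z in unitBall n, ENNReal.ofReal (c
      * (F z * (cutGreen n (cut K) (‖z‖ ^ 2) / (1 - ‖z‖ ^ 2) ^ (n + 1))))) Filter.atTop := by
    have hae : ∀ᵐ z ∂(volume.restrict (unitBall n)),
        Filter.liminf (fun K => ENNReal.ofReal (c
          * (F z * (cutGreen n (cut K) (‖z‖ ^ 2) / (1 - ‖z‖ ^ 2) ^ (n + 1))))) Filter.atTop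
        = ENNReal.ofReal (c * (F z * (green z / (1 - ‖z‖ ^ 2) ^ (n + 1)))) := by
      have hne : ∀ᵐ z ∂(volume.restrict (unitBall n)), z ≠ 0 :=
        ae_restrict_of_ae (by simp [ae_iff])
      filter_upwards [ae_restrict_mem measurableSet_ball, hne] with z hz hz0
      refine Filter.Tendsto.liminf_eq (ENNReal.tendsto_ofReal ?_)
      exact (((tendsto_cutGreen hn hz0 (hball z hz)).div_const _).const_mul _).const_mul _
    rw [← lintegral_congr_ae hae]
    have hFme : AEMeasurable F (volume.restrict (unitBall n)) :=
      hFm.aemeasurable measurableSet_ball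
    have hev : ∀ K, 2 ≤ K → AEMeasurable (fun z => ENNReal.ofReal (c
      * (F z * (cutGreen n (cut K) (‖z‖ ^ 2) / (1 - ‖z‖ ^ 2) ^ (n + 1)))))
      (volume.restrict (unitBall n)) := by
      intro K hK2
      have hcm : Measurable (cutGreen n (cut K)) :=
        (isCutoff_cut hK2).contDiff_cutGreen.continuous.measurable
      fun_prop
    -- `cut K` is known to be an admissible cutoff only for `K ≥ 2`; the shift provides
    -- measurability for every index.
    have hsh : ∀ f : ℕ → ENNReal, Filter.liminf (fun K => f (K + 2)) Filter.atTop
        = Filter.liminf f Filter.atTop := fun f => Filter.liminf_nat_add f 2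
    have := lintegral_liminf_le' (μ := volume.restrict (unitBall n)) (u := Filter.atTop)
      (f := fun K z => ENNReal.ofReal (c
        * (F z * (cutGreen n (cut (K + 2)) (‖z‖ ^ 2) / (1 - ‖z‖ ^ 2) ^ (n + 1)))))
      (fun K => hev _ (by omega))
    have e1 := fun z => hsh fun K => ENNReal.ofReal (c
        * (F z * (cutGreen n (cut K) (‖z‖ ^ 2) / (1 - ‖z‖ ^ 2) ^ (n + 1))))
    have e2 := hsh fun K => ∫⁻ z in unitBall n, ENNReal.ofReal (c
        * (F z * (cutGreen n (cut K) (‖z‖ ^ 2) / (1 - ‖z‖ ^ 2) ^ (n + 1))))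
    simpa only [e1, e2] using this
  refine hFat.trans ?_
  have hlim := Filter.liminf_le_of_frequently_le' (hK ε (by exact_mod_cast hε)).frequently
  refine hlim.trans ?_
  rw [ENNReal.ofReal_add (integral_nonneg fun _ => hq0 _) (by positivity)]
  simp

end Estimate

/-! ### The weighted inequality, its semicontinuity and its Bochner form -/

section Energy

/-- The density of `|f|² dν` with respect to Lebesgue measure. -/
def energyDensity (φ : Cn n → ℝ) (f : Cn n → ℂ) (z : Cn n) : ℝ :=
  (n.factorial : ℝ) / Real.pi ^ n
    * (‖f z‖ ^ 2 * invLaplacian φ z * (green z / (1 - ‖z‖ ^ 2) ^ (n + 1)))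

/-- The integral of `|f|²` against the measure `ν`. -/
def energy (φ : Cn n → ℝ) (f : Cn n → ℂ) : ℝ≥0∞ :=
  ∫⁻ z in unitBall n, ENNReal.ofReal (energyDensity φ f z)

lemma weight_pos {z : Cn n} (hz : z ∈ unitBall n) : 0 < (1 - ‖z‖ ^ 2) ^ (n + 1) := by
  have h : ‖z‖ < 1 := by simpa using hz
  have : 0 < 1 - ‖z‖ ^ 2 := by nlinarith [norm_nonneg z]
  positivity

lemma energyDensity_nonneg {φ : Cn n → ℝ} (hφ : IsInvSubharmonic φ) (f : Cn n → ℂ) {z : Cn n}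
    (hz : z ∈ unitBall n) : 0 ≤ energyDensity φ f z := by
  have h1 := hφ.nonneg z hz
  have h2 := weight_pos hz
  have h3 : 0 ≤ green z := green_nonneg (by simpa using hz)
  unfold energyDensity
  positivity

lemma aemeasurable_green (hn : 1 ≤ n) :
    AEMeasurable (green : Cn n → ℝ) (volume.restrict (unitBall n)) := by
  have := nontrivial_Cn hn
  have hne : ∀ᵐ z ∂((volume : Measure (Cn n)).restrict (unitBall n)), z ≠ 0 :=
    ae_restrict_of_ae (by simp [ae_iff])
  refine aemeasurable_of_tendsto_metrizable_ae (u := Filter.atTop)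
    (f := fun K z => cutGreen n (cut (K + 2)) (‖z‖ ^ 2)) (fun K => ?_) ?_
  · have hcm : Measurable (cutGreen n (cut (K + 2))) :=
      (isCutoff_cut (by omega)).contDiff_cutGreen.continuous.measurable
    fun_prop
  · filter_upwards [ae_restrict_mem measurableSet_ball, hne] with z hz hz0
    exact (tendsto_cutGreen hn hz0 (by simpa using hz)).comp (Filter.tendsto_add_atTop_nat 2)

lemma aemeasurable_invLaplacian {φ : Cn n → ℝ} (hφ : IsInvSubharmonic φ) :
    AEMeasurable (invLaplacian φ) (volume.restrict (unitBall n)) :=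
  (continuousOn_invLaplacian hφ.contDiffOn).aemeasurable measurableSet_ball

lemma aemeasurable_energyDensity (hn : 1 ≤ n) {φ : Cn n → ℝ} (hφ : IsInvSubharmonic φ)
    {f : Cn n → ℂ} (hf : AEMeasurable f (volume.restrict (unitBall n))) :
    AEMeasurable (energyDensity φ f) (volume.restrict (unitBall n)) := by
  have h1 := aemeasurable_green hn
  have h2 := aemeasurable_invLaplacian hφ
  unfold energyDensity
  fun_prop

/-- The weighted inequality for holomorphic functions smooth up to the boundary. -/
theorem energy_le_of_contDiff (hn : 1 ≤ n) {φ : Cn n → ℝ} (hφ : IsInvSubharmonic φ)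
    (hneg : ∀ z ∈ unitBall n, φ z ≤ 0) {M : ℝ} (hM : 0 < M)
    (hbdd : ∀ z ∈ unitBall n, |φ z| ≤ M) {p : Cn n → ℂ} (hp : ContDiff ℂ 2 p) :
    energy φ p ≤ ENNReal.ofReal (Real.exp 1 * M
      * ∫ ξ : unitSphere n, ‖p ξ‖ ^ 2 ∂(sphereMeasure n)) := by
  have hpc : Continuous p := hp.continuous
  have hφd : ∀ z ∈ unitBall n, ContDiffAt ℝ 2 φ z := fun z hz =>
    hφ.contDiffOn.contDiffAt (isOpen_ball.mem_nhds hz)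
  have hψd : ∀ z ∈ unitBall n, ContDiffAt ℝ 2 (fun w => M⁻¹ * φ w) z := fun z hz =>
    contDiffAt_const.mul (hφd z hz)
  -- With a weight `e^{tφ}` in place of `e^{φ/M}` the same argument yields the constant `e^{tM}/t`.
  -- It is smallest at `t = 1/M`, where it equals `e M`.
  have key := lintegral_invLaplacian_mul_green_le hn
    (u := fun z => Real.exp (M⁻¹ * φ z) * ‖p z‖ ^ 2) (q := fun z => ‖p z‖ ^ 2)
    (F := fun z => (Real.exp 1 * M)⁻¹ * (‖p z‖ ^ 2 * invLaplacian φ z)) (by fun_prop)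
    (fun z => by positivity)
    (fun z hz => (Real.contDiff_exp.contDiffAt.comp z (hψd z hz)).mul
      ((hp.restrict_scalars ℝ).contDiffAt.norm_sq ℝ))
    (fun z _ => by positivity)
    (fun z hz => by
      have h1 : M⁻¹ * φ z ≤ 0 := mul_nonpos_of_nonneg_of_nonpos (by positivity) (hneg z hz)
      exact mul_le_of_le_one_left (by positivity) (Real.exp_le_one_iff.2 h1))
    (continuousOn_const.mul ((hpc.norm.pow 2).continuousOn.mul
      (continuousOn_invLaplacian hφ.contDiffOn)))
    (fun z hz => by
      have := hφ.nonneg z hz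
      positivity)
    (fun z hz => by
      refine le_trans ?_ (le_invLaplacian_exp_mul hz (hψd z hz) hp)
      rw [invLaplacian_const_mul _ (hφd z hz)]
      have h1 : -1 ≤ M⁻¹ * φ z := by
        have := (abs_le.1 (hbdd z hz)).1
        rw [inv_mul_eq_div, le_div_iff₀ hM]
        linarith
      have h2 := hφ.nonneg z hz
      have h3 : (Real.exp 1)⁻¹ ≤ Real.exp (M⁻¹ * φ z) := by
        rw [← Real.exp_neg]
        exact Real.exp_le_exp.2 h1
      calc (Real.exp 1 * M)⁻¹ * (‖p z‖ ^ 2 * invLaplacian φ z)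
          = (Real.exp 1)⁻¹ * ‖p z‖ ^ 2 * (M⁻¹ * invLaplacian φ z) := by
            rw [mul_inv]; ring
        _ ≤ _ := by gcongr)
  have hE : energy φ p = ENNReal.ofReal (Real.exp 1 * M) * ∫⁻ z in unitBall n,
      ENNReal.ofReal ((n.factorial : ℝ) / Real.pi ^ n * ((Real.exp 1 * M)⁻¹
        * (‖p z‖ ^ 2 * invLaplacian φ z) * (green z / (1 - ‖z‖ ^ 2) ^ (n + 1)))) := by
    rw [← lintegral_const_mul' _ _ ENNReal.ofReal_ne_top, energy]
    refine lintegral_congr fun z => ?_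
    rw [← ENNReal.ofReal_mul (by positivity), energyDensity]
    congr 1
    field_simp
  rw [hE, ENNReal.ofReal_mul (p := Real.exp 1 * M) (by positivity)]
  exact mul_le_mul' le_rfl key

/-- Lower semicontinuity of the energy. -/
lemma energy_le_of_tendsto (hn : 1 ≤ n) {φ : Cn n → ℝ} (hφ : IsInvSubharmonic φ)
    {f : Cn n → ℂ} {p : ℕ → Cn n → ℂ} (hp : ∀ k, Continuous (p k))
    (hlim : ∀ z ∈ unitBall n, Filter.Tendsto (fun k => p k z) Filter.atTop (nhds (f z)))
    {b : ℕ → ℝ} {B : ℝ} (hb : ∀ k, energy φ (p k) ≤ ENNReal.ofReal (b k))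
    (hB : Filter.Tendsto b Filter.atTop (nhds B)) : energy φ f ≤ ENNReal.ofReal B := by
  have hae : ∀ᵐ z ∂(volume.restrict (unitBall n)),
      Filter.liminf (fun k => ENNReal.ofReal (energyDensity φ (p k) z)) Filter.atTop
      = ENNReal.ofReal (energyDensity φ f z) := by
    filter_upwards [ae_restrict_mem measurableSet_ball] with z hz
    refine Filter.Tendsto.liminf_eq (ENNReal.tendsto_ofReal ?_)
    exact ((((hlim z hz).norm.pow 2).mul_const _).mul_const _).const_mul _
  rw [energy, ← lintegral_congr_ae hae]
  refine (lintegral_liminf_le' fun k =>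
    (aemeasurable_energyDensity hn hφ (hp k).aemeasurable).ennreal_ofReal).trans ?_
  rw [← (ENNReal.tendsto_ofReal hB).liminf_eq]
  exact Filter.liminf_le_liminf (Filter.Eventually.of_forall hb)

lemma invMeasure_eq_withDensity (n : ℕ) : invMeasure n
    = (volume.restrict (unitBall n)).withDensity
      fun z => ((Real.toNNReal (1 / (1 - ‖z‖ ^ 2) ^ (n + 1)) : ℝ≥0) : ℝ≥0∞) := rfl

lemma integrable_of_energy_le (hn : 1 ≤ n) {φ : Cn n → ℝ} (hφ : IsInvSubharmonic φ)
    {f : Cn n → ℂ} (hf : AEMeasurable f (volume.restrict (unitBall n))) {B : ℝ} (hB0 : 0 ≤ B)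
    (hB : energy φ f ≤ ENNReal.ofReal B) :
    Integrable (fun z => ‖f z‖ ^ 2 * invLaplacian φ z * green z) (invMeasure n) ∧
      (n.factorial : ℝ) / Real.pi ^ n
        * ∫ z, ‖f z‖ ^ 2 * invLaplacian φ z * green z ∂(invMeasure n) ≤ B := by
  have hm : Measurable fun z : Cn n => Real.toNNReal (1 / (1 - ‖z‖ ^ 2) ^ (n + 1)) := by fun_prop
  have hc : (0 : ℝ) < (n.factorial : ℝ) / Real.pi ^ n := by positivity
  have hnn : 0 ≤ᵐ[volume.restrict (unitBall n)] energyDensity φ f := by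
    filter_upwards [ae_restrict_mem measurableSet_ball] with z hz
    exact energyDensity_nonneg hφ f hz
  have hms := (aemeasurable_energyDensity hn hφ hf).aestronglyMeasurable
  have hE : Integrable (energyDensity φ f) (volume.restrict (unitBall n)) := by
    refine ⟨hms, ?_⟩
    rw [hasFiniteIntegral_iff_ofReal hnn]
    exact lt_of_le_of_lt hB ENNReal.ofReal_lt_top
  have hcongr : (fun z => ((n.factorial : ℝ) / Real.pi ^ n)⁻¹ * energyDensity φ f z)
      =ᵐ[volume.restrict (unitBall n)] fun z =>
        Real.toNNReal (1 / (1 - ‖z‖ ^ 2) ^ (n + 1)) • (‖f z‖ ^ 2 * invLaplacian φ z * green z) := by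
    filter_upwards [ae_restrict_mem measurableSet_ball] with z hz
    have := weight_pos hz
    rw [NNReal.smul_def, Real.coe_toNNReal _ (by positivity), energyDensity, smul_eq_mul]
    field_simp
  rw [invMeasure_eq_withDensity]
  constructor
  · rw [integrable_withDensity_iff_integrable_smul hm]
    exact (hE.const_mul _).congr hcongr
  · rw [integral_withDensity_eq_integral_smul hm, ← integral_congr_ae hcongr, integral_const_mul,
      ← mul_assoc, mul_inv_cancel₀ hc.ne', one_mul]
    rw [integral_eq_lintegral_of_nonneg_ae hnn hms]
    exact ENNReal.toReal_le_of_le_ofReal hB0 hB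

lemma potentialMeasure_apply (hn : 1 ≤ n) {φ : Cn n → ℝ} (hφ : IsInvSubharmonic φ)
    {s : Set (Cn n)} (hs : MeasurableSet s) :
    potentialMeasure φ s = ∫⁻ z in s ∩ unitBall n, ENNReal.ofReal (energyDensity φ 1 z) := by
  have hm : Measurable fun z : Cn n => ENNReal.ofReal (1 / (1 - ‖z‖ ^ 2) ^ (n + 1)) := by fun_prop
  have h1 := aemeasurable_green hn
  have h2 := aemeasurable_invLaplacian hφ
  rw [potentialMeasure, withDensity_apply _ hs, invMeasure, restrict_withDensity hs,
    Measure.restrict_restrict hs, lintegral_withDensity_eq_lintegral_mul₀ hm.aemeasurable]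
  · refine setLIntegral_congr_fun (hs.inter measurableSet_ball) fun z hz => ?_
    have := weight_pos hz.2
    simp only [Pi.mul_apply]
    rw [← ENNReal.ofReal_mul (by positivity), energyDensity]
    congr 1
    simp
    ring
  · refine AEMeasurable.mono_measure (μ := volume.restrict (unitBall n)) ?_
      (Measure.restrict_mono Set.inter_subset_right le_rfl)
    fun_prop

end Energy

/-! ### Moments of the sphere by Gaussian integration -/

section Moments

/-- Uniqueness of Haar measure. The value of `κ` is left open because it cancels once the sphere is
normalized. -/
lemma exists_integral_eq_mul_integral_pi (n : ℕ) : ∃ κ : ℂ, ∀ F : Cn n → ℂ,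
    ∫ z, F z = κ * ∫ x : Fin n → ℂ, F (WithLp.toLp 2 x) := by
  let e : (Fin n → ℂ) ≃L[ℝ] Cn n := (PiLp.continuousLinearEquiv 2 ℝ fun _ : Fin n => ℂ).symm
  have h1 : (Measure.map e volume).IsAddHaarMeasure := e.isAddHaarMeasure_map volume
  have h2 := Measure.isAddLeftInvariant_eq_smul (volume : Measure (Cn n)) (Measure.map e volume)
  obtain ⟨κ, hκ⟩ : ∃ κ : ℝ≥0, (volume : Measure (Cn n)) = κ • Measure.map e volume := ⟨_, h2⟩
  refine ⟨((κ : ℝ) : ℂ), fun F => ?_⟩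
  have h3 : ∫ y, F y ∂(Measure.map e volume) = ∫ x, F (e x) :=
    e.toHomeomorph.measurableEmbedding.integral_map F
  rw [hκ, integral_smul_nnreal_measure, h3, NNReal.smul_def, Complex.real_smul]
  rfl

lemma integral_complex_gaussian_moment (a b : ℕ) :
    ∫ z : ℂ, z ^ a * starRingEnd ℂ z ^ b * Real.exp (-‖z‖ ^ 2)
      = if a = b then (Real.pi * a.factorial : ℂ) else 0 := by
  split_ifs with h
  · subst h
    have h1 : ∀ z : ℂ, z ^ a * starRingEnd ℂ z ^ a * Real.exp (-‖z‖ ^ 2)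
        = ((‖z‖ ^ (2 * a : ℝ) * Real.exp (-‖z‖ ^ (2 : ℝ)) : ℝ) : ℂ) := by
      intro z
      rw [← mul_pow, Complex.mul_conj, Complex.normSq_eq_norm_sq,
        Real.rpow_mul (norm_nonneg z), Real.rpow_natCast]
      simp
    simp only [h1]
    rw [integral_complex_ofReal, Complex.integral_rpow_mul_exp_neg_rpow (by norm_num)
      (by have : (0 : ℝ) ≤ a := by positivity
          linarith),
      show ((2 * a + 2 : ℝ) / 2) = a + 1 by ring, Real.Gamma_nat_eq_factorial]
    push_cast
    ring
  · have hab : ((a : ℝ) - b) ≠ 0 := sub_ne_zero.2 (by exact_mod_cast h)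
    -- Rotation by this angle multiplies the integrand by `e^{iπ} = -1` and preserves Lebesgue
    -- measure, so the integral equals its negative.
    set c : Circle := Circle.exp (Real.pi / (a - b)) with hc
    have hcc : (c : ℂ) ^ a * starRingEnd ℂ (c : ℂ) ^ b = -1 := by
      rw [hc, Circle.coe_exp, ← Complex.exp_conj, ← Complex.exp_nat_mul, ← Complex.exp_nat_mul,
        ← Complex.exp_add, ← Complex.exp_pi_mul_I]
      congr 1
      have : ((a : ℂ) - b) ≠ 0 := by exact_mod_cast hab
      simp
      field_simp
      ring
    set I := ∫ z : ℂ, z ^ a * starRingEnd ℂ z ^ b * Real.exp (-‖z‖ ^ 2) with hI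
    have h1 := (rotation c).measurePreserving.integral_comp
      (rotation c).toHomeomorph.measurableEmbedding
      (fun z : ℂ => z ^ a * starRingEnd ℂ z ^ b * Real.exp (-‖z‖ ^ 2))
    have h2 : ∀ z : ℂ, (rotation c z) ^ a * starRingEnd ℂ (rotation c z) ^ b
        * (Real.exp (-‖rotation c z‖ ^ 2) : ℂ)
        = (-1) * (z ^ a * starRingEnd ℂ z ^ b * Real.exp (-‖z‖ ^ 2)) := by
      intro z
      rw [LinearIsometryEquiv.norm_map, rotation_apply, ← hcc, map_mul]
      ring
    simp only [h2] at h1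
    rw [integral_const_mul, ← hI] at h1
    linear_combination (-1 / 2) * h1

lemma integral_radial_gaussian (N : ℕ) :
    ∫ t in Set.Ioi (0 : ℝ), (t : ℂ) ^ N * (Real.exp (-t ^ 2) : ℂ)
      = ((1 / 2 * Real.Gamma ((N + 1) / 2) : ℝ) : ℂ) := by
  have h := integral_rpow_mul_exp_neg_rpow (p := 2) (q := N) (by norm_num)
    (by have : (0 : ℝ) ≤ N := by positivity
        linarith)
  rw [← h, ← integral_complex_ofReal]
  refine setIntegral_congr_fun measurableSet_Ioi fun t _ => ?_
  simp

/-- The monomial `z^a conj(z)^b`. -/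
def bimonomial (a b : Fin n → ℕ) (z : Cn n) : ℂ :=
  ∏ i, (z i ^ a i * starRingEnd ℂ (z i) ^ b i)

lemma bimonomial_smul (a b : Fin n → ℕ) (t : ℝ) (z : Cn n) :
    bimonomial a b (t • z) = bimonomial a b z * (t : ℂ) ^ (∑ i, a i + ∑ i, b i) := by
  simp only [bimonomial, PiLp.smul_apply, Complex.real_smul, map_mul, Complex.conj_ofReal]
  rw [pow_add, ← Finset.prod_pow_eq_pow_sum, ← Finset.prod_pow_eq_pow_sum, ← Finset.prod_mul_distrib,
    ← Finset.prod_mul_distrib]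
  exact Finset.prod_congr rfl fun i _ => by ring

/-- The integral of a bimonomial times a Gaussian is computed twice: in polar coordinates it is the
sphere moment times a Gamma value, and by Fubini it is a product of one-variable moments. -/
lemma exists_moment (hn : 1 ≤ n) : ∃ κ : ℂ, ∀ a b : Fin n → ℕ,
    (∫ ξ : unitSphere n, bimonomial a b ξ ∂(surface n))
      * ((1 / 2 * Real.Gamma ((2 * n + (∑ i, a i + ∑ i, b i) : ℝ) / 2) : ℝ) : ℂ)
      = κ * if a = b then ∏ i, ((a i).factorial : ℂ) else 0 := by
  obtain ⟨κ, hκ⟩ := exists_integral_eq_mul_integral_pi n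
  refine ⟨κ * Real.pi ^ n, fun a b => ?_⟩
  have h1 := integral_polar_mul (𝕜 := ℂ) hn
    (F := fun z => bimonomial a b z * (Real.exp (-‖z‖ ^ 2) : ℂ))
    (fun ξ => bimonomial a b ξ)
    (fun t => (t : ℂ) ^ (∑ i, a i + ∑ i, b i) * (Real.exp (-t ^ 2) : ℂ)) (fun ξ t ht => by
      have hξ : ‖(ξ : Cn n)‖ = 1 := by simp
      rw [bimonomial_smul, norm_smul, hξ, mul_one, Real.norm_of_nonneg ht.le]
      ring)
  have h2 : ∫ t in Set.Ioi (0 : ℝ), ((t : ℝ) : ℂ) ^ (2 * n - 1)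
      * ((t : ℂ) ^ (∑ i, a i + ∑ i, b i) * (Real.exp (-t ^ 2) : ℂ))
      = ((1 / 2 * Real.Gamma ((2 * n + (∑ i, a i + ∑ i, b i) : ℝ) / 2) : ℝ) : ℂ) := by
    simp only [← mul_assoc, ← pow_add]
    rw [integral_radial_gaussian]
    have : (((2 * n - 1 + (∑ i, a i + ∑ i, b i) : ℕ) : ℝ) + 1)
        = 2 * n + (∑ i, a i + ∑ i, b i) := by
      push_cast [Nat.cast_sub (show 1 ≤ 2 * n by omega)]
      ring
    rw [this]
  have h3 : ∫ z : Cn n, bimonomial a b z * (Real.exp (-‖z‖ ^ 2) : ℂ)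
      = κ * ∏ i, ∫ z : ℂ, z ^ a i * starRingEnd ℂ z ^ b i * Real.exp (-‖z‖ ^ 2) := by
    rw [hκ, ← integral_fintype_prod_eq_prod (μ := fun _ => (volume : Measure ℂ))
      (fun i (z : ℂ) => z ^ a i * starRingEnd ℂ z ^ b i * (Real.exp (-‖z‖ ^ 2) : ℂ))]
    congr 1
    refine integral_congr_ae (Filter.Eventually.of_forall fun x => ?_)
    simp only [bimonomial]
    rw [Finset.prod_mul_distrib (g := fun i => (Real.exp (-‖x i‖ ^ 2) : ℂ)),
      EuclideanSpace.norm_sq_eq, ← Finset.sum_neg_distrib, Real.exp_sum]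
    push_cast
    rfl
  simp only [RCLike.ofReal_eq_complex_ofReal] at h1
  rw [h2, h3] at h1
  rw [← h1]
  simp only [integral_complex_gaussian_moment]
  by_cases hab : a = b
  · subst hab
    simp [Finset.prod_mul_distrib]
    ring
  · obtain ⟨i, hi⟩ : ∃ i, a i ≠ b i := Function.ne_iff.1 hab
    rw [if_neg hab, Finset.prod_eq_zero (Finset.mem_univ i) (if_neg hi)]
    simp

/-- The moments of the normalized surface measure. -/
theorem integral_bimonomial (hn : 1 ≤ n) (a b : Fin n → ℕ) :
    ∫ ξ : unitSphere n, bimonomial a b ξ ∂(sphereMeasure n)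
      = if a = b then (∏ i, ((a i).factorial : ℂ)) * (n - 1).factorial
          / (n - 1 + ∑ i, a i).factorial else 0 := by
  obtain ⟨κ, hκ⟩ := exists_moment hn
  have hprob := isProbabilityMeasure_sphereMeasure hn
  obtain ⟨m, rfl⟩ : ∃ m, n = m + 1 := ⟨n - 1, by omega⟩
  have hG : ∀ d : ℕ, Real.Gamma ((2 * ((m + 1 : ℕ) : ℝ) + ((d : ℝ) + d)) / 2) = (m + d).factorial := by
    intro d
    rw [← Real.Gamma_nat_eq_factorial]
    congr 1
    push_cast
    ring
  -- The zero exponents relate `κ` to the total surface mass, so `κ` can be eliminated.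
  have h0 := hκ 0 0
  have e0 : bimonomial (0 : Fin (m + 1) → ℕ) 0 = fun _ => 1 := by ext z; simp [bimonomial]
  have hG0 := hG 0
  simp only [e0, Pi.zero_apply, Nat.cast_zero, Finset.sum_const_zero, if_true, Nat.factorial_zero,
    Nat.cast_one, Finset.prod_const_one, mul_one] at h0
  have h1 := integral_sphereMeasure hn (fun _ : unitSphere (m + 1) => (1 : ℂ))
  have h2 := integral_sphereMeasure hn (fun ξ : unitSphere (m + 1) => bimonomial a b ξ)
  have hC : ((((m + 1).factorial : ℝ) / Real.pi ^ (m + 1) / (2 * ((m + 1 : ℕ) : ℝ)) : ℝ) : ℂ) ≠ 0 := by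
    have : (0 : ℝ) < ((m + 1).factorial : ℝ) / Real.pi ^ (m + 1) / (2 * ((m + 1 : ℕ) : ℝ)) := by
      positivity
    exact_mod_cast this.ne'
  set C : ℝ := ((m + 1).factorial : ℝ) / Real.pi ^ (m + 1) / (2 * ((m + 1 : ℕ) : ℝ))
  set S : ℂ := ∫ ξ : unitSphere (m + 1), bimonomial a b ξ ∂(surface (m + 1))
  set S₀ : ℂ := ∫ ξ : unitSphere (m + 1), (1 : ℂ) ∂(surface (m + 1))
  have hab : S * _ = _ := hκ a b
  rw [h2, Complex.real_smul]
  simp only [integral_const, probReal_univ, one_smul, Complex.real_smul] at h1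
  simp only [Nat.cast_zero, Nat.add_zero] at hG0
  rw [hG0] at h0
  by_cases h : a = b
  · subst h
    rw [if_pos rfl] at hab ⊢
    rw [hG] at hab
    have hf : ((m + ∑ i, a i).factorial : ℂ) ≠ 0 := by exact_mod_cast Nat.factorial_ne_zero _
    rw [Nat.add_sub_cancel, eq_div_iff hf]
    push_cast at hab h0
    linear_combination (2 * C) * hab - 2 * C * (∏ i, ((a i).factorial : ℂ)) * h0
      - (∏ i, ((a i).factorial : ℂ)) * m.factorial * h1
  · rw [if_neg h, mul_zero] at hab
    rw [if_neg h]
    have hpos : (0 : ℝ) < 1 / 2 * Real.Gamma ((2 * ((m + 1 : ℕ) : ℝ)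
        + (((∑ i, a i : ℕ) : ℝ) + ((∑ i, b i : ℕ) : ℝ))) / 2) :=
      mul_pos (by norm_num) (Real.Gamma_pos_of_pos (by positivity))
    rcases mul_eq_zero.1 hab with h3 | h3
    · rw [h3, mul_zero]
    · exact absurd (by exact_mod_cast h3) hpos.ne'

end Moments

/-! ### The Cauchy-Szegő formula for polynomials -/

section Cauchy

lemma herm_eq_sum (z w : Cn n) : herm z w = ∑ i, z i * starRingEnd ℂ (w i) := by
  simp [herm, PiLp.inner_apply]

lemma norm_herm_le (z w : Cn n) : ‖herm z w‖ ≤ ‖z‖ * ‖w‖ := by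
  rw [herm, mul_comm]
  exact norm_inner_le_norm w z

lemma herm_conj (z w : Cn n) : starRingEnd ℂ (herm z w) = herm w z := by
  simp [herm]

lemma herm_self (z : Cn n) : herm z z = ((‖z‖ ^ 2 : ℝ) : ℂ) := by
  rw [herm, inner_self_eq_norm_sq_to_K]
  push_cast
  rfl

lemma continuous_herm_left (w : Cn n) : Continuous fun z : Cn n => herm z w := by
  unfold herm; fun_prop

lemma continuous_herm_right (z : Cn n) : Continuous fun w : Cn n => herm z w := by
  unfold herm; fun_prop

instance : IsFiniteMeasure (sphereMeasure n) := by
  constructor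
  rw [sphereMeasure, Measure.smul_apply, smul_eq_mul]
  exact (ENNReal.inv_mul_le_one _).trans_lt ENNReal.one_lt_top

lemma integrable_of_continuous {g : unitSphere n → ℂ} (hg : Continuous g) :
    Integrable g (sphereMeasure n) :=
  hg.integrable_of_hasCompactSupport (HasCompactSupport.of_compactSpace _)

lemma continuous_bimonomial (a b : Fin n → ℕ) : Continuous (bimonomial a b) := by
  have hc : ∀ i : Fin n, Continuous fun z : Cn n => z i := fun i =>
    (contDiff_coord (k := 0) i).continuous
  unfold bimonomial
  refine continuous_finsetProd _ fun i _ => ?_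
  have := hc i
  have := Complex.continuous_conj
  fun_prop

/-- In the multinomial expansion of the power, orthogonality of monomials leaves only the exponent
`a`. The binomial coefficient, which is that of `x^k` in `(1 - x)^{-n}`, exactly cancels the moment
against the multinomial coefficient. -/
lemma integral_monomial_mul_herm_pow (hn : 1 ≤ n) (a : Fin n → ℕ) (z : Cn n) (k : ℕ) :
    ((k + (n - 1)).choose (n - 1) : ℂ) * ∫ ξ : unitSphere n, (∏ i, (ξ : Cn n) i ^ a i) * herm z ξ ^ k
      ∂(sphereMeasure n) = if k = ∑ i, a i then ∏ i, z i ^ a i else 0 := by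
  have h1 : ∀ ξ : Cn n, (∏ i, ξ i ^ a i) * herm z ξ ^ k
      = ∑ b ∈ Finset.piAntidiag Finset.univ k,
        ((Nat.multinomial Finset.univ b : ℂ) * ∏ i, z i ^ b i) * bimonomial a b ξ := by
    intro ξ
    rw [herm_eq_sum, Finset.sum_pow_eq_sum_piAntidiag, Finset.mul_sum]
    refine Finset.sum_congr rfl fun b _ => ?_
    simp only [bimonomial, mul_pow, Finset.prod_mul_distrib]
    ring
  simp only [h1]
  have hi : ∀ b : Fin n → ℕ, Integrable (fun ξ : unitSphere n => bimonomial a b ξ)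
      (sphereMeasure n) := fun b =>
    integrable_of_continuous ((continuous_bimonomial a b).comp continuous_subtype_val)
  rw [integral_finsetSum _ fun b _ => (hi b).const_mul _]
  simp only [integral_const_mul, integral_bimonomial hn]
  split_ifs with hk
  · rw [Finset.sum_eq_single a]
    · rw [if_pos rfl]
      have hm : (∏ i, ((a i).factorial : ℂ)) * (Nat.multinomial Finset.univ a : ℂ)
          = (k.factorial : ℂ) := by
        rw [hk]
        exact_mod_cast Nat.multinomial_spec Finset.univ a
      have hc : ((k + (n - 1)).choose (n - 1) : ℂ) * k.factorial * (n - 1).factorial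
          = (n - 1 + ∑ i, a i).factorial := by
        rw [← hk, add_comm (n - 1) k]
        have := Nat.choose_mul_factorial_mul_factorial (Nat.le_add_left (n - 1) k)
        rw [Nat.add_sub_cancel, mul_right_comm] at this
        exact_mod_cast this
      have hf : ((n - 1 + ∑ i, a i).factorial : ℂ) ≠ 0 := by
        exact_mod_cast Nat.factorial_ne_zero _
      rw [← mul_div_assoc, ← mul_div_assoc, div_eq_iff hf, ← hc, ← hm]
      ring
    · intro b _ hb
      rw [if_neg (Ne.symm hb), mul_zero]
    · intro ha
      exact absurd (by simp [Finset.mem_piAntidiag, hk]) ha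
  · rw [Finset.sum_eq_zero, mul_zero]
    intro b hb
    rw [if_neg, mul_zero]
    rintro rfl
    exact hk (by simpa using (Finset.mem_piAntidiag.1 hb).1.symm)

lemma norm_herm_lt_one {z : Cn n} (hz : z ∈ unitBall n) (ξ : unitSphere n) :
    ‖herm z ξ‖ ≤ ‖z‖ ∧ ‖z‖ < 1 := by
  refine ⟨?_, by simpa using hz⟩
  simpa using norm_herm_le z (ξ : Cn n)

lemma one_sub_herm_ne_zero {z : Cn n} (hz : z ∈ unitBall n) (ξ : unitSphere n) :
    1 - herm z ξ ≠ 0 := by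
  intro h
  have h1 := norm_herm_lt_one hz ξ
  rw [← sub_eq_zero.1 h, norm_one] at h1
  linarith

/-- The Cauchy-Szegő formula for monomials. -/
lemma integral_monomial_div (hn : 1 ≤ n) (a : Fin n → ℕ) {z : Cn n} (hz : z ∈ unitBall n) :
    ∫ ξ : unitSphere n, (∏ i, (ξ : Cn n) i ^ a i) / (1 - herm z ξ) ^ n ∂(sphereMeasure n)
      = ∏ i, z i ^ a i := by
  have hprob := isProbabilityMeasure_sphereMeasure hn
  have hz1 : ‖z‖ < 1 := by simpa using hz
  set F : ℕ → unitSphere n → ℂ := fun k ξ => ((k + (n - 1)).choose (n - 1) : ℂ)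
    * ((∏ i, (ξ : Cn n) i ^ a i) * herm z ξ ^ k) with hF
  have hmon : ∀ ξ : unitSphere n, ‖∏ i, (ξ : Cn n) i ^ a i‖ ≤ 1 := by
    intro ξ
    rw [norm_prod]
    refine Finset.prod_le_one (fun i _ => norm_nonneg _) fun i _ => ?_
    rw [norm_pow]
    refine pow_le_one₀ (norm_nonneg _) ?_
    have := PiLp.norm_apply_le (ξ : Cn n) i
    simpa using this
  have hcont : ∀ k, Continuous (F k) := by
    intro k
    have h1 := (continuous_herm_right z).comp (continuous_subtype_val (p := (· ∈ unitSphere n)))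
    have h2 : ∀ i : Fin n, Continuous fun ξ : unitSphere n => (ξ : Cn n) i := fun i =>
      (contDiff_coord (k := 0) i).continuous.comp continuous_subtype_val
    have h3 : Continuous fun ξ : unitSphere n => ∏ i, (ξ : Cn n) i ^ a i :=
      continuous_finsetProd _ fun i _ => (h2 i).pow _
    exact continuous_const.mul (h3.mul (h1.pow k))
  have hbound : ∀ k ξ, ‖F k ξ‖ ≤ ((k + (n - 1)).choose (n - 1) : ℝ) * ‖z‖ ^ k := by
    intro k ξ
    simp only [hF, norm_mul, norm_pow, Complex.norm_natCast]
    gcongr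
    calc _ ≤ 1 * ‖z‖ ^ k := by
          gcongr
          · exact hmon ξ
          · exact (norm_herm_lt_one hz ξ).1
      _ = _ := one_mul _
  have hsumm : Summable fun k : ℕ => ((k + (n - 1)).choose (n - 1) : ℝ) * ‖z‖ ^ k :=
    (hasSum_choose_mul_geometric_of_norm_lt_one (n - 1) (by simpa using hz1)).summable
  -- The binomial series of the kernel may be integrated termwise, being dominated on the sphere by
  -- its value at `|z| < 1`.
  have hs := hasSum_integral_of_summable_integral_norm (F := F) (μ := sphereMeasure n)
    (fun k => integrable_of_continuous (hcont k)) (by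
      refine Summable.of_nonneg_of_le (fun k => integral_nonneg fun _ => norm_nonneg _)
        (fun k => ?_) hsumm
      calc _ ≤ ∫ ξ : unitSphere n, ((k + (n - 1)).choose (n - 1) : ℝ) * ‖z‖ ^ k
              ∂(sphereMeasure n) :=
            integral_mono (integrable_of_continuous (hcont k)).norm (integrable_const _)
              (hbound k)
        _ = _ := by simp)
  have e1 : ∀ ξ : unitSphere n, ∑' k, F k ξ = (∏ i, (ξ : Cn n) i ^ a i) / (1 - herm z ξ) ^ n := by
    intro ξ
    have h1 := norm_herm_lt_one hz ξ
    have := (hasSum_choose_mul_geometric_of_norm_lt_one (n - 1)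
      (h1.1.trans_lt h1.2)).mul_left (∏ i, (ξ : Cn n) i ^ a i)
    rw [Nat.sub_add_cancel hn, mul_one_div] at this
    rw [← this.tsum_eq]
    exact tsum_congr fun k => by simp only [hF]; ring
  simp only [e1] at hs
  refine hs.unique ?_
  have e2 : ∀ k, ∫ ξ, F k ξ ∂(sphereMeasure n) = if k = ∑ i, a i then ∏ i, z i ^ a i else 0 := by
    intro k
    rw [← integral_monomial_mul_herm_pow hn a z k, ← integral_const_mul]
  simp only [e2]
  exact hasSum_ite_eq _ _

/-- The Cauchy-Szegő formula for polynomials. -/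
theorem hardyExt_eq_eval (hn : 1 ≤ n) {g : SphereL2 n} {p : MvPolynomial (Fin n) ℂ}
    (hg : ∀ᵐ ξ ∂(sphereMeasure n), g ξ = MvPolynomial.eval (fun i => (ξ : Cn n) i) p)
    {z : Cn n} (hz : z ∈ unitBall n) : hardyExt g z = MvPolynomial.eval (fun i => z i) p := by
  have h1 : hardyExt g z = ∫ ξ : unitSphere n, ∑ d ∈ p.support, p.coeff d *
      ((∏ i, (ξ : Cn n) i ^ d i) / (1 - herm z ξ) ^ n) ∂(sphereMeasure n) := by
    refine integral_congr_ae ?_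
    filter_upwards [hg] with ξ hξ
    rw [hξ, MvPolynomial.eval_eq', Finset.sum_div]
    exact Finset.sum_congr rfl fun d _ => mul_div_assoc _ _ _
  rw [h1, integral_finsetSum]
  · simp only [integral_const_mul, integral_monomial_div hn _ hz]
    rw [MvPolynomial.eval_eq']
  · intro d _
    refine (integrable_of_continuous ?_).const_mul _
    have h1 := (continuous_herm_right z).comp (continuous_subtype_val (p := (· ∈ unitSphere n)))
    have h2 : ∀ i : Fin n, Continuous fun ξ : unitSphere n => (ξ : Cn n) i := fun i =>
      (contDiff_coord (k := 0) i).continuous.comp continuous_subtype_val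
    exact (continuous_finsetProd _ fun i _ => (h2 i).pow _).div ((continuous_const.sub h1).pow n)
      fun ξ => pow_ne_zero _ (one_sub_herm_ne_zero hz ξ)

end Cauchy

/-! ### The Szegő kernel as a reproducing element of the Hardy space -/

section Kernel

lemma one_sub_herm_ne_zero' {z : Cn n} (hz : z ∈ unitBall n) (ξ : unitSphere n) :
    1 - herm (ξ : Cn n) z ≠ 0 := by
  rw [← herm_conj z, ← map_one (starRingEnd ℂ), ← map_sub]
  exact (map_ne_zero _).2 (one_sub_herm_ne_zero hz ξ)

/-- The function `⟨·, z⟩` on the sphere. -/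
def hermC (z : Cn n) : C(unitSphere n, ℂ) :=
  ⟨fun ξ => herm (ξ : Cn n) z, (continuous_herm_left z).comp continuous_subtype_val⟩

/-- The Cauchy-Szegő kernel on the sphere. -/
def szegoC {z : Cn n} (hz : z ∈ unitBall n) : C(unitSphere n, ℂ) :=
  ⟨fun ξ => 1 / (1 - herm (ξ : Cn n) z) ^ n, continuous_const.div
    ((continuous_const.sub ((continuous_herm_left z).comp continuous_subtype_val)).pow n)
    fun ξ => pow_ne_zero _ (one_sub_herm_ne_zero' hz ξ)⟩

/-- The Cauchy-Szegő kernel as an element of `L²(σ)`. -/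
def szego {z : Cn n} (hz : z ∈ unitBall n) : SphereL2 n :=
  ContinuousMap.toLp 2 (sphereMeasure n) ℂ (szegoC hz)

lemma szego_coe {z : Cn n} (hz : z ∈ unitBall n) :
    ∀ᵐ ξ ∂(sphereMeasure n), szego hz ξ = 1 / (1 - herm (ξ : Cn n) z) ^ n :=
  ContinuousMap.coeFn_toLp (sphereMeasure n) (szegoC hz)

/-- Point evaluations thereby become bounded functionals on `L²(σ)`, so norm convergence forces
pointwise convergence of the extensions. -/
lemma hardyExt_eq_inner {z : Cn n} (hz : z ∈ unitBall n) (f : SphereL2 n) :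
    hardyExt f z = inner ℂ (szego hz) f := by
  rw [L2.inner_def]
  refine integral_congr_ae ?_
  filter_upwards [szego_coe hz] with ξ hξ
  rw [hξ, RCLike.inner_apply, map_div₀, map_one, map_pow, map_sub, map_one, herm_conj,
    mul_one_div]

lemma tendsto_hardyExt {z : Cn n} (hz : z ∈ unitBall n) {g : ℕ → SphereL2 n} {f : SphereL2 n}
    (h : Filter.Tendsto g Filter.atTop (nhds f)) :
    Filter.Tendsto (fun k => hardyExt (g k) z) Filter.atTop (nhds (hardyExt f z)) := by
  simp only [hardyExt_eq_inner hz]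
  exact ((innerSL ℂ (szego hz)).continuous.tendsto f).comp h

lemma norm_sq_szego {z : Cn n} (hz : z ∈ unitBall n) :
    ((‖szego hz‖ ^ 2 : ℝ) : ℂ) = hardyExt (szego hz) z := by
  rw [hardyExt_eq_inner hz, inner_self_eq_norm_sq_to_K]
  push_cast
  rfl

/-- The partial sums of the expansion of the Cauchy-Szegő kernel. -/
def szegoPoly (z : Cn n) (N : ℕ) : MvPolynomial (Fin n) ℂ :=
  ∑ k ∈ Finset.range N, MvPolynomial.C ((k + (n - 1)).choose (n - 1) : ℂ)
    * (∑ i, MvPolynomial.X i * MvPolynomial.C (starRingEnd ℂ (z i))) ^ k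

lemma eval_szegoPoly (z w : Cn n) (N : ℕ) :
    MvPolynomial.eval (fun i => w i) (szegoPoly z N)
      = ∑ k ∈ Finset.range N, ((k + (n - 1)).choose (n - 1) : ℂ) * herm w z ^ k := by
  simp [szegoPoly, herm_eq_sum, map_sum]

lemma hasSum_szegoC (hn : 1 ≤ n) {z : Cn n} (hz : z ∈ unitBall n) :
    HasSum (fun k : ℕ => ((k + (n - 1)).choose (n - 1) : ℂ) • hermC z ^ k) (szegoC hz) := by
  have hz1 : ‖z‖ < 1 := by simpa using hz
  have hh : ‖hermC z‖ ≤ ‖z‖ := by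
    rw [ContinuousMap.norm_le _ (norm_nonneg z)]
    intro ξ
    simpa [hermC] using norm_herm_le (ξ : Cn n) z
  have hs : Summable (fun k : ℕ => ((k + (n - 1)).choose (n - 1) : ℂ) • hermC z ^ k) := by
    have h := (hasSum_choose_mul_geometric_of_norm_lt_one (𝕜 := ℝ) (n - 1) (r := ‖z‖)
      (by simpa using hz1)).summable
    refine Summable.of_norm_bounded h fun k => ?_
    rw [norm_smul, Complex.norm_natCast]
    gcongr
    have hne := nontrivial_Cn hn
    have : Nonempty (unitSphere n) :=
      (NormedSpace.sphere_nonempty (x := (0 : Cn n)).2 zero_le_one).to_subtype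
    exact (norm_pow_le _ _).trans (by gcongr)
  obtain ⟨S, hS⟩ := hs
  suffices S = szegoC hz by rwa [this] at hS
  ext ξ
  have h1 := hS.mapL (ContinuousMap.evalCLM ℂ ξ)
  have h2 : ‖herm (ξ : Cn n) z‖ < 1 := by
    have := norm_herm_le (ξ : Cn n) z
    simp at this
    linarith
  have h3 := hasSum_choose_mul_geometric_of_norm_lt_one (n - 1) h2
  rw [Nat.sub_add_cancel hn] at h3
  exact h1.unique (by simpa [hermC, szegoC] using h3)

lemma tendsto_szegoPoly (hn : 1 ≤ n) {z : Cn n} (hz : z ∈ unitBall n) :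
    ∃ g : ℕ → SphereL2 n, (∀ N, ∀ᵐ ξ ∂(sphereMeasure n),
      g N ξ = MvPolynomial.eval (fun i => (ξ : Cn n) i) (szegoPoly z N)) ∧
      Filter.Tendsto g Filter.atTop (nhds (szego hz)) := by
  refine ⟨fun N => ContinuousMap.toLp 2 (sphereMeasure n) ℂ
    (∑ k ∈ Finset.range N, ((k + (n - 1)).choose (n - 1) : ℂ) • hermC z ^ k), fun N => ?_, ?_⟩
  · filter_upwards [ContinuousMap.coeFn_toLp (𝕜 := ℂ) (p := 2) (sphereMeasure n)
      (∑ k ∈ Finset.range N, ((k + (n - 1)).choose (n - 1) : ℂ) • hermC z ^ k)] with ξ hξ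
    rw [hξ, eval_szegoPoly, ContinuousMap.sum_apply]
    rfl
  · exact ((ContinuousMap.toLp 2 (sphereMeasure n) ℂ).continuous.tendsto _).comp
      (hasSum_szegoC hn hz).tendsto_sum_nat

lemma szego_mem_hardySpace (hn : 1 ≤ n) {z : Cn n} (hz : z ∈ unitBall n) :
    szego hz ∈ hardySpace n := by
  obtain ⟨g, hg, hlim⟩ := tendsto_szegoPoly hn hz
  exact mem_closure_of_tendsto hlim (Filter.Eventually.of_forall fun N => ⟨_, hg N⟩)

/-- The partial sums of the kernel are polynomials, which extend as themselves; both limits are then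
identified at `w`. -/
lemma hardyExt_szego (hn : 1 ≤ n) {z w : Cn n} (hz : z ∈ unitBall n) (hw : w ∈ unitBall n) :
    hardyExt (szego hz) w = 1 / (1 - herm w z) ^ n := by
  obtain ⟨g, hg, hlim⟩ := tendsto_szegoPoly hn hz
  have h1 := tendsto_hardyExt hw hlim
  simp only [hardyExt_eq_eval hn (hg _) hw, eval_szegoPoly] at h1
  have h2 : ‖herm w z‖ < 1 := by
    have := norm_herm_le w z
    have h3 : ‖z‖ < 1 := by simpa using hz
    have h4 : ‖w‖ < 1 := by simpa using hw
    nlinarith [norm_nonneg z, norm_nonneg w]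
  have h3 := (hasSum_choose_mul_geometric_of_norm_lt_one (n - 1) h2).tendsto_sum_nat
  rw [Nat.sub_add_cancel hn] at h3
  exact tendsto_nhds_unique h1 h3

end Kernel

/-! ### The inequality on the Hardy space and the Carleson condition -/

section Main

lemma contDiff_eval (p : MvPolynomial (Fin n) ℂ) {k : WithTop ℕ∞} :
    ContDiff ℂ k fun z : Cn n => MvPolynomial.eval (fun i => z i) p := by
  simp only [MvPolynomial.eval_eq']
  refine ContDiff.sum fun d _ => contDiff_const.mul (contDiff_prod fun i _ => ContDiff.pow ?_ _)
  exact (EuclideanSpace.proj i : Cn n →L[ℂ] ℂ).contDiff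

lemma norm_sq_eq_integral (f : SphereL2 n) :
    ‖f‖ ^ 2 = ∫ ξ, ‖f ξ‖ ^ 2 ∂(sphereMeasure n) := by
  have h := L2.inner_def (𝕜 := ℂ) f f
  simp only [inner_self_eq_norm_sq_to_K] at h
  have h2 : ∀ ξ, ((‖f ξ‖ : ℝ) : ℂ) ^ 2 = ((‖f ξ‖ ^ 2 : ℝ) : ℂ) := fun ξ => by push_cast; rfl
  simp only [RCLike.ofReal_eq_complex_ofReal, h2] at h
  rw [integral_complex_ofReal] at h
  exact_mod_cast h

variable {φ : Cn n → ℝ}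

/-- The inequality for the Hardy space, together with the measurability of the extension. -/
lemma energy_hardyExt_le (hn : 1 ≤ n) (hφ : IsInvSubharmonic φ)
    (hneg : ∀ z ∈ unitBall n, φ z ≤ 0) {M : ℝ} (hM : 0 < M)
    (hbdd : ∀ z ∈ unitBall n, |φ z| ≤ M) {f : SphereL2 n} (hf : f ∈ hardySpace n) :
    AEMeasurable (hardyExt f) (volume.restrict (unitBall n)) ∧
      energy φ (hardyExt f) ≤ ENNReal.ofReal (Real.exp 1 * M * ‖f‖ ^ 2) := by
  rw [hardySpace, mem_closure_iff_seq_limit] at hf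
  obtain ⟨g, hg, hlim⟩ := hf
  choose p hp using hg
  have hc : ∀ k, Continuous fun z : Cn n => MvPolynomial.eval (fun i => z i) (p k) := fun k =>
    (contDiff_eval (p k) (k := 0)).continuous
  have hpt : ∀ z ∈ unitBall n, Filter.Tendsto
      (fun k => MvPolynomial.eval (fun i => z i) (p k)) Filter.atTop (nhds (hardyExt f z)) := by
    intro z hz
    have := tendsto_hardyExt hz hlim
    simpa only [hardyExt_eq_eval hn (hp _) hz] using this
  have hb : ∀ k, energy φ (fun z => MvPolynomial.eval (fun i => z i) (p k))
      ≤ ENNReal.ofReal (Real.exp 1 * M * ‖g k‖ ^ 2) := by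
    intro k
    refine (energy_le_of_contDiff hn hφ hneg hM hbdd (contDiff_eval (p k))).trans_eq ?_
    rw [norm_sq_eq_integral]
    congr 2
    refine integral_congr_ae ?_
    filter_upwards [hp k] with ξ hξ
    rw [hξ]
  have hB : Filter.Tendsto (fun k => Real.exp 1 * M * ‖g k‖ ^ 2) Filter.atTop
      (nhds (Real.exp 1 * M * ‖f‖ ^ 2)) := (hlim.norm.pow 2).const_mul _
  constructor
  · refine aemeasurable_of_tendsto_metrizable_ae (u := Filter.atTop)
      (f := fun k (z : Cn n) => MvPolynomial.eval (fun i => z i) (p k))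
      (fun k => (hc k).aemeasurable) ?_
    filter_upwards [ae_restrict_mem measurableSet_ball] with z hz using hpt z hz
  · exact energy_le_of_tendsto hn hφ hc hpt hb hB

lemma measurableSet_carlesonBox (ξ : Cn n) (r : ℝ) :
    MeasurableSet {z ∈ unitBall n | ‖1 - herm z ξ‖ < r} := by
  have h : Continuous fun z : Cn n => ‖1 - herm z ξ‖ :=
    (continuous_const.sub (continuous_herm_left ξ)).norm
  exact measurableSet_ball.inter (measurableSet_lt h.measurable measurable_const)

/-- The Carleson box condition follows by testing on a Cauchy-Szegő kernel. -/
lemma potentialMeasure_carlesonBox_le (hn : 1 ≤ n) (hφ : IsInvSubharmonic φ)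
    (hneg : ∀ z ∈ unitBall n, φ z ≤ 0) {M : ℝ} (hM : 0 < M)
    (hbdd : ∀ z ∈ unitBall n, |φ z| ≤ M) {ξ : Cn n} (hξ : ξ ∈ unitSphere n) {r : ℝ} (hr : 0 < r) :
    potentialMeasure φ {z ∈ unitBall n | ‖1 - herm z ξ‖ < r}
      ≤ ENNReal.ofReal (Real.exp 1 * M * 4 ^ n * r ^ n) := by
  have hξ1 : ‖ξ‖ = 1 := by simpa using hξ
  -- The pole `(1 - ρ) ξ` lies at depth comparable to the box. Capping at `1` covers large `r`,
  -- where the pole is the origin and the kernel is constant.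
  set ρ : ℝ := min r 1 with hρ
  have hρ0 : 0 < ρ := lt_min hr one_pos
  have hρ1 : ρ ≤ 1 := min_le_right _ _
  set η : Cn n := (1 - ρ) • ξ with hη
  have hηn : ‖η‖ = 1 - ρ := by
    rw [hη, norm_smul, hξ1, mul_one, Real.norm_of_nonneg (by linarith)]
  have hηb : η ∈ unitBall n := by simp [hηn, hρ0]
  obtain ⟨-, hE⟩ := energy_hardyExt_le hn hφ hneg hM hbdd (szego_mem_hardySpace hn hηb)
  -- The reproducing property gives `(1 - |η|²)^{-n}`, and `1 - (1 - ρ)² = ρ (2 - ρ) ≥ ρ`.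
  have hnorm : ‖szego hηb‖ ^ 2 ≤ (ρ ^ n)⁻¹ := by
    have h1 := norm_sq_szego hηb
    rw [hardyExt_szego hn hηb hηb, herm_self, hηn] at h1
    have h2 : ‖szego hηb‖ ^ 2 = 1 / (1 - (1 - ρ) ^ 2) ^ n := by exact_mod_cast h1
    rw [h2, one_div]
    gcongr
    nlinarith
  have hher : ∀ z ∈ unitBall n, herm z η = (1 - ρ : ℝ) * herm z ξ := by
    intro z _
    simp only [herm_eq_sum, hη, Finset.mul_sum, PiLp.smul_apply, Complex.real_smul, map_mul,
      Complex.conj_ofReal]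
    exact Finset.sum_congr rfl fun i _ => by ring
  have hlow : ∀ z ∈ {z ∈ unitBall n | ‖1 - herm z ξ‖ < r},
      1 ≤ (2 * ρ) ^ (2 * n) * ‖hardyExt (szego hηb) z‖ ^ 2 := by
    rintro z ⟨hz, hzr⟩
    have hz1 : ‖z‖ < 1 := by simpa using hz
    have hle : ‖herm z ξ‖ ≤ 1 := by
      have := norm_herm_le z ξ
      rw [hξ1, mul_one] at this
      linarith
    have hne : ‖herm z η‖ < 1 := by
      have := norm_herm_le z η
      nlinarith [norm_nonneg z, norm_nonneg η]
    have hpos : 0 < ‖1 - herm z η‖ := by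
      rw [norm_pos_iff, sub_ne_zero]
      intro h
      rw [← h, norm_one] at hne
      exact lt_irrefl _ hne
    -- For `r ≤ 1`, moving the pole from `ξ` to `η` costs at most `ρ = r`; otherwise `η = 0` and the
    -- left side is `1`.
    have hup : ‖1 - herm z η‖ ≤ 2 * ρ := by
      rcases le_total r 1 with h | h
      · have hρr : ρ = r := min_eq_left h
        have e : 1 - herm z η = (1 - herm z ξ) + (ρ : ℂ) * herm z ξ := by
          rw [hher z hz]; push_cast; ring
        rw [e]
        refine (norm_add_le _ _).trans ?_
        rw [norm_mul, Complex.norm_real, Real.norm_of_nonneg hρ0.le]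
        nlinarith [norm_nonneg (herm z ξ)]
      · have hρr : ρ = 1 := min_eq_right h
        rw [hher z hz, hρr]
        norm_num
    rw [hardyExt_szego hn hηb hz, norm_div, norm_one, norm_pow, div_pow, one_pow, ← pow_mul,
      mul_comm n 2, mul_one_div, one_le_div (by positivity)]
    gcongr
  have hms := measurableSet_carlesonBox ξ r
  rw [potentialMeasure_apply hn hφ hms]
  have hsub : {z ∈ unitBall n | ‖1 - herm z ξ‖ < r} ∩ unitBall n ⊆ unitBall n :=
    Set.inter_subset_right
  calc ∫⁻ z in {z ∈ unitBall n | ‖1 - herm z ξ‖ < r} ∩ unitBall n,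
        ENNReal.ofReal (energyDensity φ 1 z)
      ≤ ∫⁻ z in {z ∈ unitBall n | ‖1 - herm z ξ‖ < r} ∩ unitBall n,
        ENNReal.ofReal ((2 * ρ) ^ (2 * n)) * ENNReal.ofReal
          (energyDensity φ (hardyExt (szego hηb)) z) := by
        refine setLIntegral_mono' (hms.inter measurableSet_ball) fun z hz => ?_
        rw [← ENNReal.ofReal_mul (by positivity)]
        refine ENNReal.ofReal_le_ofReal ?_
        have h1 := energyDensity_nonneg hφ 1 hz.2
        have e : (2 * ρ) ^ (2 * n) * energyDensity φ (hardyExt (szego hηb)) z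
            = ((2 * ρ) ^ (2 * n) * ‖hardyExt (szego hηb) z‖ ^ 2) * energyDensity φ 1 z := by
          simp only [energyDensity, Pi.one_apply, norm_one]
          ring
        rw [e]
        exact le_mul_of_one_le_left h1 (hlow z hz.1)
    _ ≤ ∫⁻ z in unitBall n, ENNReal.ofReal ((2 * ρ) ^ (2 * n)) * ENNReal.ofReal
          (energyDensity φ (hardyExt (szego hηb)) z) := lintegral_mono_set hsub
    _ = ENNReal.ofReal ((2 * ρ) ^ (2 * n)) * energy φ (hardyExt (szego hηb)) :=
        lintegral_const_mul' _ _ ENNReal.ofReal_ne_top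
    _ ≤ ENNReal.ofReal ((2 * ρ) ^ (2 * n))
          * ENNReal.ofReal (Real.exp 1 * M * ‖szego hηb‖ ^ 2) := by gcongr
    _ ≤ _ := by
        rw [← ENNReal.ofReal_mul (by positivity)]
        refine ENNReal.ofReal_le_ofReal ?_
        calc (2 * ρ) ^ (2 * n) * (Real.exp 1 * M * ‖szego hηb‖ ^ 2)
            ≤ (2 * ρ) ^ (2 * n) * (Real.exp 1 * M * (ρ ^ n)⁻¹) := by gcongr
          _ = Real.exp 1 * M * 4 ^ n * ρ ^ n := by
              rw [mul_pow, pow_mul, pow_mul, pow_right_comm ρ]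
              norm_num
              field_simp
          _ ≤ _ := by
              gcongr
              exact min_le_left _ _

end Main

end

end CarlesonBall

theorem corollary2p2 (n : ℕ) (hn : 1 ≤ n) (φ : CarlesonBall.Cn n → ℝ)
    (hφ : CarlesonBall.IsInvSubharmonic φ)
    (hneg : ∀ z ∈ CarlesonBall.unitBall n, φ z ≤ 0)
    (hbdd : ∃ M : ℝ, ∀ z ∈ CarlesonBall.unitBall n, |φ z| ≤ M) :
    CarlesonBall.IsCarleson (CarlesonBall.potentialMeasure φ) ∧
    ∀ f ∈ CarlesonBall.hardySpace n,
      MeasureTheory.Integrable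
        (fun z => ‖CarlesonBall.hardyExt f z‖ ^ 2 * CarlesonBall.invLaplacian φ z *
          CarlesonBall.green z) (CarlesonBall.invMeasure n) ∧
      (Nat.factorial n : ℝ) / Real.pi ^ n *
          ∫ z, ‖CarlesonBall.hardyExt f z‖ ^ 2 * CarlesonBall.invLaplacian φ z *
            CarlesonBall.green z ∂(CarlesonBall.invMeasure n)
        ≤ Real.exp 1 * CarlesonBall.supNormBall φ * ‖f‖ ^ 2 := by
  obtain ⟨M, hM⟩ := hbdd
  have hsup : ∀ z ∈ CarlesonBall.unitBall n, |φ z| ≤ CarlesonBall.supNormBall φ := fun z hz =>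
    le_ciSup (f := fun z : CarlesonBall.unitBall n => |φ z|)
      ⟨M, by rintro _ ⟨w, rfl⟩; exact hM w w.2⟩ ⟨z, hz⟩
  have hsup0 : 0 ≤ CarlesonBall.supNormBall φ :=
    (abs_nonneg _).trans (hsup 0 (Metric.mem_ball_self one_pos))
  -- The argument divides by the bound on `|φ|`, while the supremum may be zero; hence the
  -- perturbation by `ε`, which tends to zero at the end.
  have hε : ∀ ε : ℝ, 0 < ε → ∀ z ∈ CarlesonBall.unitBall n,
      |φ z| ≤ CarlesonBall.supNormBall φ + ε := fun ε hε z hz => by linarith [hsup z hz]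
  constructor
  · refine ⟨Real.toNNReal (Real.exp 1 * (CarlesonBall.supNormBall φ + 1) * 4 ^ n),
      fun ξ hξ r hr => ?_⟩
    refine (CarlesonBall.potentialMeasure_carlesonBox_le hn hφ hneg (by linarith)
      (hε 1 one_pos) hξ hr).trans_eq ?_
    rw [ENNReal.ofReal_mul (by positivity)]
    rfl
  · intro f hf
    have key : ∀ ε : ℝ, 0 < ε → _ := fun ε h =>
      CarlesonBall.energy_hardyExt_le hn hφ hneg (show 0 < CarlesonBall.supNormBall φ + ε by linarith)
        (hε ε h) hf
    have key2 := fun (ε : ℝ) (h : 0 < ε) => CarlesonBall.integrable_of_energy_le hn hφ (key ε h).1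
      (by positivity) (key ε h).2
    refine ⟨(key2 1 one_pos).1, ?_⟩
    have hlim : Filter.Tendsto
        (fun ε : ℝ => Real.exp 1 * (CarlesonBall.supNormBall φ + ε) * ‖f‖ ^ 2)
        (nhdsWithin 0 (Set.Ioi 0)) (nhds (Real.exp 1 * CarlesonBall.supNormBall φ * ‖f‖ ^ 2)) := by
      have hc : Continuous fun ε : ℝ =>
          Real.exp 1 * (CarlesonBall.supNormBall φ + ε) * ‖f‖ ^ 2 := by fun_prop
      have := (hc.tendsto 0).mono_left (nhdsWithin_le_nhds (s := Set.Ioi 0))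
      simpa only [add_zero] using this
    refine ge_of_tendsto hlim ?_
    filter_upwards [self_mem_nhdsWithin] with ε h
    exact (key2 ε h).2
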